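/- Let $\mathcal G$ be a Hausdorff locally compact étale groupoid (no amenability or second countability is assumed), with source and range maps $s,r\colon\mathcal G\to\mathcal G^{(0)}$. Put $\mathcal G_x=s^{-1}(x)$, $\mathcal G^x=r^{-1}(x)$, $\mathcal G^x_x=\mathcal G_x\cap\mathcal G^x$ and $\mathrm{Iso}(\mathcal G)=\{g\in\mathcal G: s(g)=r(g)\}$. Let $C^*(\mathcal G)$ be the full groupoid C$^*$-algebra, i.e. the completion of the $*$-algebra $C_c(\mathcal G)$, with product $(f_1*f_2)(g)=\sum_{h\in\mathcal G^{r(g)}}f_1(h)f_2(h^{-1}g)$ and involution $f^*(g)=\overline{f(g^{-1})}$, in the norm $\|f\|=\sup_\pi\|\pi(f)\|$, where $\pi$ runs through all representations of $C_c(\mathcal G)$ by bounded operators on Hilbert spaces. Let $\operatorname{Prim}C^*(\mathcal G)$ be the set of kernels of irreducible representations of $C^*(\mathcal G)$ with the Jacobson topology, whose closed sets are the sets $\{I: J\subset I\}$ for closed two-sided ideals $J\subset C^*(\mathcal G)$. Let $\operatorname{Char}(\mathcal G)$ be the set of pairs $(x,\chi)$, where $x\in\mathcal G^{(0)}$ and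 $\chi\colon\mathcal G^x_x\to\mathbb T$ is a character (a group homomorphism into the unit circle), with the topology that has as a basis the finite intersections of the sets $$\mathcal O(U,K,V)=\{(x,\chi): x\in U,\ \chi(K\cap\mathcal G^x_x)\subset V\},$$ for $U\subset\mathcal G^{(0)}$ open, $K\subset\mathrm{Iso}(\mathcal G)$ compact and $V\subset\mathbb T$ open. The groupoid acts on $\operatorname{Char}(\mathcal G)$ by $g(x,\chi)=(r(g),\chi(g^{-1}\cdot g))$ for $g\in\mathcal G_x$, and for $A\subset\operatorname{Char}(\mathcal G)$ we write $\mathcal GA=\{g(x,\chi): (x,\chi)\in A,\ g\in\mathcal G_x\}$. For $(x,\chi)\in\operatorname{Char}(\mathcal G)$, let $\operatorname{Ind}(x,\chi)\in\operatorname{Prim}C^*(\mathcal G)$ be the kernel of the (irreducible) representation $\pi^\chi_x$ of $C^*(\mathcal G)$ induced by $\chi$: it acts on the Hilbert space of functions $\xi\colon\mathcal G_x\to\mathbb C$ such that $\xi(gh)=\overline{\chi(h)}\,\xi(g)$ for $g\in\mathcal G_x$, $h\in\mathcal G^x_x$, and $\sum_{g\in\mathcal G_x/\mathcal G^x_x}|\xi(g)|^2<\infty$,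 by $(\pi^\chi_x(f)\xi)(g)=\sum_{h\in\mathcal G^{r(g)}}f(h)\,\xi(h^{-1}g)$ for $f\in C_c(\mathcal G)$. **Theorem.** Let $(x,\chi)\in\operatorname{Char}(\mathcal G)$ and $A\subset\operatorname{Char}(\mathcal G)$. If $\operatorname{Ind}(x,\chi)$ lies in the closure of $\operatorname{Ind}A=\{\operatorname{Ind}(y,\eta):(y,\eta)\in A\}$ in $\operatorname{Prim}C^*(\mathcal G)$, then $(x,\chi)$ lies in the closure of $\mathcal GA$ in $\operatorname{Char}(\mathcal G)$. -/

import Mathlib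

open scoped CompactlySupported ENNReal InnerProductSpace

universe u

set_option linter.unusedSectionVars false


section PrimitiveIdeals

universe v w

/-- A representation is irreducible if it is nonzero and has no closed invariant subspaces
other than zero and the whole space. -/
def IsIrreducibleRep {A : Type w} [NonUnitalCStarAlgebra A] {H : Type v} [NormedAddCommGroup H]
    [InnerProductSpace ℂ H] [CompleteSpace H] (π : A →⋆ₙₐ[ℂ] (H →L[ℂ] H)) : Prop :=
  (∃ a ξ, π a ξ ≠ 0) ∧
    ∀ K : Submodule ℂ H, IsClosed (K : Set H) → (∀ a, ∀ ξ ∈ K, π a ξ ∈ K) → K = ⊥ ∨ K = ⊤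

/-- Primitive ideals: the kernels of irreducible representations on Hilbert spaces (in the universe
`v`). -/
def IsPrimitiveIdeal {A : Type w} [NonUnitalCStarAlgebra A] (I : TwoSidedIdeal A) : Prop :=
  ∃ (H : Type v) (_ : NormedAddCommGroup H) (_ : InnerProductSpace ℂ H) (_ : CompleteSpace H)
    (π : A →⋆ₙₐ[ℂ] (H →L[ℂ] H)), IsIrreducibleRep π ∧ I = TwoSidedIdeal.ker π

/-- The set `Prim A` of primitive ideals. -/
def CStarPrim (A : Type w) [NonUnitalCStarAlgebra A] : Type w :=
  {I : TwoSidedIdeal A // IsPrimitiveIdeal.{v} I}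

namespace CStarPrim

variable {A : Type w} [NonUnitalCStarAlgebra A]

/-- The set of the primitive ideals that contain `J`. -/
def hull (J : TwoSidedIdeal A) : Set (CStarPrim.{v} A) := {I | J ≤ I.1}

theorem isClosed_coe (I : CStarPrim.{v} A) : IsClosed (I.1 : Set A) := by
  obtain ⟨I, H, _, _, _, π, -, rfl⟩ := I
  have h : ((TwoSidedIdeal.ker π : TwoSidedIdeal A) : Set A) = π ⁻¹' {0} := by
    ext a
    exact TwoSidedIdeal.mem_ker π
  change IsClosed ((TwoSidedIdeal.ker π : TwoSidedIdeal A) : Set A)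
  rw [h]
  exact isClosed_singleton.preimage
    (AddMonoidHomClass.continuous_of_bound π 1 fun a => by
      rw [one_mul]
      exact NonUnitalStarAlgHom.norm_apply_le π a)

theorem le_or_le (I : CStarPrim.{v} A) {J J' : TwoSidedIdeal A} (h : J ⊓ J' ≤ I.1) :
    J ≤ I.1 ∨ J' ≤ I.1 := by
  obtain ⟨I, H, _, _, _, π, hπ, rfl⟩ := I
  change J ⊓ J' ≤ TwoSidedIdeal.ker π at h
  change J ≤ TwoSidedIdeal.ker π ∨ J' ≤ TwoSidedIdeal.ker π
  let K : Submodule ℂ H :=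
    { carrier := {ξ | ∀ b ∈ J', π b ξ = 0}
      zero_mem' := fun b _ => map_zero _
      add_mem' := fun hx hy b hb => by rw [map_add, hx b hb, hy b hb, add_zero]
      smul_mem' := fun c x hx b hb => by rw [map_smul, hx b hb, smul_zero] }
  have hK : IsClosed (K : Set H) := by
    have : (K : Set H) = ⋂ b ∈ J', {ξ | π b ξ = 0} := by
      ext ξ
      simp [K]
    rw [this]
    exact isClosed_biInter fun b _ => isClosed_eq (π b).continuous continuous_const
  rcases hπ.2 K hK (fun a ξ hξ b hb => by
    rw [← mul_apply_eq_comp, ← map_mul]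
    exact hξ _ (J'.mul_mem_right _ _ hb)) with h0 | h1
  · left
    intro a ha
    rw [TwoSidedIdeal.mem_ker]
    ext ξ
    have : π a ξ ∈ K := fun b hb => by
      rw [← mul_apply_eq_comp, ← map_mul,
        (TwoSidedIdeal.mem_ker π).1 (h ⟨J.mul_mem_left _ _ ha, J'.mul_mem_right _ _ hb⟩)]
      rfl
    rw [h0, Submodule.mem_bot] at this
    rw [this]
    rfl
  · right
    intro b hb
    rw [TwoSidedIdeal.mem_ker]
    ext ξ
    have : ξ ∈ K := by
      rw [h1]
      trivial
    exact this b hb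

/-- The Jacobson topology: the closed sets are the hulls of the closed two-sided ideals. -/
instance : TopologicalSpace (CStarPrim.{v} A) :=
  TopologicalSpace.ofClosed {C | ∃ J : TwoSidedIdeal A, IsClosed (J : Set A) ∧ C = hull J}
    ⟨⊤, by simp, by
      symm
      rw [Set.eq_empty_iff_forall_notMem]
      rintro ⟨I, H, _, _, _, π, hπ, rfl⟩ hI
      obtain ⟨a, ξ, ha⟩ := hπ.1
      have : a ∈ TwoSidedIdeal.ker π := hI (show a ∈ (⊤ : TwoSidedIdeal A) by simp)
      rw [TwoSidedIdeal.mem_ker] at this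
      exact ha (by rw [this]; rfl)⟩
    (fun S hS => by
      refine ⟨sInf (Subtype.val '' ⋂₀ S), ?_, ?_⟩
      · have : ((sInf (Subtype.val '' ⋂₀ S) : TwoSidedIdeal A) : Set A) =
            ⋂ I ∈ ⋂₀ S, (I.1 : Set A) := by
          ext a
          rw [SetLike.mem_coe, TwoSidedIdeal.mem_sInf]
          simp only [Set.forall_mem_image, Set.mem_iInter, SetLike.mem_coe]
          exact Iff.rfl
        rw [this]
        exact isClosed_biInter fun I _ => I.isClosed_coe
      · refine Set.Subset.antisymm ?_ fun I hI C hC => ?_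
        · intro I hI
          exact sInf_le (Set.mem_image_of_mem Subtype.val hI)
        · obtain ⟨J, -, rfl⟩ := hS hC
          refine le_trans (le_sInf ?_) (show _ ≤ I.1 from hI)
          rintro _ ⟨I', hI', rfl⟩
          exact hI' _ hC)
    (by
      rintro _ ⟨J, hJ, rfl⟩ _ ⟨J', hJ', rfl⟩
      refine ⟨J ⊓ J', ?_, ?_⟩
      · have : ((J ⊓ J' : TwoSidedIdeal A) : Set A) = (J : Set A) ∩ J' := rfl
        rw [this]
        exact hJ.inter hJ'
      · refine subset_antisymm ?_ fun I hI => I.le_or_le hI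
        rintro I (hI | hI)
        · exact inf_le_left.trans (show J ≤ I.1 from hI)
        · exact inf_le_right.trans (show J' ≤ I.1 from hI))

end CStarPrim

end PrimitiveIdeals

/-- An étale groupoid with space of arrows `G` and space of units `X`: a topological groupoid whose
source and range maps are local homeomorphisms. The space of units is embedded into the
space of arrows by `unit`. The product `mul g h` is meaningful only when `src g = rng h`
(`mul` is a total function for convenience; its values at the other pairs are arbitrary and are
never used). -/
structure EtaleGroupoid (X G : Type u) [TopologicalSpace X] [TopologicalSpace G] where
  src : G → X
  rng : G → X
  unit : X → G
  inv : G → G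
  mul : G → G → G
  src_unit : ∀ x, src (unit x) = x
  rng_unit : ∀ x, rng (unit x) = x
  src_inv : ∀ g, src (inv g) = rng g
  rng_inv : ∀ g, rng (inv g) = src g
  src_mul : ∀ g h, src g = rng h → src (mul g h) = src h
  rng_mul : ∀ g h, src g = rng h → rng (mul g h) = rng g
  mul_assoc : ∀ g h k, src g = rng h → src h = rng k → mul (mul g h) k = mul g (mul h k)
  unit_mul : ∀ g, mul (unit (rng g)) g = g
  mul_unit : ∀ g, mul g (unit (src g)) = g
  inv_mul : ∀ g, mul (inv g) g = unit (src g)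
  mul_inv : ∀ g, mul g (inv g) = unit (rng g)
  continuous_unit : Continuous unit
  continuous_inv : Continuous inv
  continuousOn_mul : ContinuousOn (fun p : G × G => mul p.1 p.2) {p | src p.1 = rng p.2}
  isLocalHomeomorph_src : IsLocalHomeomorph src
  isLocalHomeomorph_rng : IsLocalHomeomorph rng

namespace EtaleGroupoid

noncomputable section

variable {X G : Type u} [TopologicalSpace X] [TopologicalSpace G]

section Algebraic

variable (Γ : EtaleGroupoid X G)

theorem inv_mul_cancel_left {g h : G} (e : Γ.src g = Γ.rng h) :
    Γ.mul (Γ.inv g) (Γ.mul g h) = h := by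
  rw [← Γ.mul_assoc _ _ _ (Γ.src_inv g) e, Γ.inv_mul, e, Γ.unit_mul]

theorem mul_inv_cancel_left {g h : G} (e : Γ.rng g = Γ.rng h) :
    Γ.mul g (Γ.mul (Γ.inv g) h) = h := by
  rw [← Γ.mul_assoc _ _ _ (Γ.rng_inv g).symm (by rw [Γ.src_inv, e]), Γ.mul_inv, e, Γ.unit_mul]

theorem mul_inv_cancel_right {g h : G} (e : Γ.src g = Γ.rng h) :
    Γ.mul (Γ.mul g h) (Γ.inv h) = g := by
  rw [Γ.mul_assoc _ _ _ e (Γ.rng_inv h).symm, Γ.mul_inv, ← e, Γ.mul_unit]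

theorem inv_mul_cancel_right {g h : G} (e : Γ.src g = Γ.src h) :
    Γ.mul (Γ.mul g (Γ.inv h)) h = g := by
  rw [Γ.mul_assoc _ _ _ (by rw [Γ.rng_inv, e]) (Γ.src_inv h), Γ.inv_mul, ← e, Γ.mul_unit]

theorem mul_left_cancel {g h k : G} (e : Γ.src g = Γ.rng h) (e' : Γ.src g = Γ.rng k)
    (H : Γ.mul g h = Γ.mul g k) : h = k := by
  rw [← Γ.inv_mul_cancel_left e, H, Γ.inv_mul_cancel_left e']

theorem eq_inv_of_mul_eq_unit {g h : G} (e : Γ.src g = Γ.rng h)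
    (H : Γ.mul g h = Γ.unit (Γ.rng g)) : h = Γ.inv g :=
  Γ.mul_left_cancel e (Γ.rng_inv g).symm (H.trans (Γ.mul_inv g).symm)

theorem inv_inv (g : G) : Γ.inv (Γ.inv g) = g :=
  (Γ.eq_inv_of_mul_eq_unit (Γ.src_inv g) (by rw [Γ.inv_mul, Γ.rng_inv])).symm

theorem inv_unit (x : X) : Γ.inv (Γ.unit x) = Γ.unit x := by
  refine (Γ.eq_inv_of_mul_eq_unit (by rw [Γ.src_unit, Γ.rng_unit]) ?_).symm
  have := Γ.unit_mul (Γ.unit x)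
  rw [Γ.rng_unit] at this ⊢
  exact this

theorem mul_inv_rev {g h : G} (e : Γ.src g = Γ.rng h) :
    Γ.inv (Γ.mul g h) = Γ.mul (Γ.inv h) (Γ.inv g) := by
  have e1 : Γ.src (Γ.inv h) = Γ.rng (Γ.inv g) := by rw [Γ.src_inv, Γ.rng_inv, e]
  refine (Γ.eq_inv_of_mul_eq_unit ?_ ?_).symm
  · rw [Γ.src_mul _ _ e, Γ.rng_mul _ _ e1, Γ.rng_inv]
  · rw [Γ.mul_assoc _ _ _ e (by rw [Γ.rng_mul _ _ e1, Γ.rng_inv]),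
      Γ.mul_inv_cancel_left (by rw [Γ.rng_inv, e]), Γ.mul_inv, Γ.rng_mul _ _ e]

/-- The isotropy group at the unit `x`: the arrows with source and range `x`. -/
def Isotropy (x : X) : Type u := {g : G // Γ.src g = x ∧ Γ.rng g = x}

/-- The group law of the isotropy group is the groupoid product. -/
instance (x : X) : Group (Γ.Isotropy x) where
  mul a b := ⟨Γ.mul a.1 b.1, by rw [Γ.src_mul _ _ (a.2.1.trans b.2.2.symm), b.2.1],
    by rw [Γ.rng_mul _ _ (a.2.1.trans b.2.2.symm), a.2.2]⟩
  one := ⟨Γ.unit x, Γ.src_unit x, Γ.rng_unit x⟩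
  inv a := ⟨Γ.inv a.1, by rw [Γ.src_inv, a.2.2], by rw [Γ.rng_inv, a.2.1]⟩
  mul_assoc a b c := Subtype.ext
    (Γ.mul_assoc _ _ _ (a.2.1.trans b.2.2.symm) (b.2.1.trans c.2.2.symm))
  one_mul a := Subtype.ext (by
    have := Γ.unit_mul a.1
    rw [a.2.2] at this
    exact this)
  mul_one a := Subtype.ext (by
    have := Γ.mul_unit a.1
    rw [a.2.1] at this
    exact this)
  inv_mul_cancel a := Subtype.ext (by
    have := Γ.inv_mul a.1
    rw [a.2.1] at this
    exact this)

/-- Conjugation by the inverse of an arrow `g` with source `x`, sending `k` to `g⁻¹ k g`, as a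
homomorphism from the isotropy group at the range of `g` to the isotropy group at `x`. -/
def conjInv (g : G) {x : X} (hg : Γ.src g = x) : Γ.Isotropy (Γ.rng g) →* Γ.Isotropy x where
  toFun k := ⟨Γ.mul (Γ.inv g) (Γ.mul k.1 g), by
      rw [Γ.src_mul, Γ.src_mul _ _ k.2.1, hg]
      rw [Γ.rng_mul _ _ k.2.1, Γ.src_inv, k.2.2], by
      rw [Γ.rng_mul, Γ.rng_inv, hg]
      rw [Γ.rng_mul _ _ k.2.1, Γ.src_inv, k.2.2]⟩
  map_one' := Subtype.ext (by
    change Γ.mul (Γ.inv g) (Γ.mul (Γ.unit (Γ.rng g)) g) = Γ.unit x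
    rw [Γ.unit_mul, Γ.inv_mul, hg])
  map_mul' k l := Subtype.ext (by
    change Γ.mul (Γ.inv g) (Γ.mul (Γ.mul k.1 l.1) g)
      = Γ.mul (Γ.mul (Γ.inv g) (Γ.mul k.1 g)) (Γ.mul (Γ.inv g) (Γ.mul l.1 g))
    have hk := k.2.1
    have hk' := k.2.2
    have hl := l.2.1
    have hl' := l.2.2
    have hlg : Γ.rng (Γ.mul l.1 g) = Γ.rng g := by rw [Γ.rng_mul _ _ hl, hl']
    have hkg : Γ.rng (Γ.mul k.1 g) = Γ.rng g := by rw [Γ.rng_mul _ _ hk, hk']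
    have e : Γ.src (Γ.mul k.1 g) = Γ.rng (Γ.mul (Γ.inv g) (Γ.mul l.1 g)) := by
      rw [Γ.src_mul _ _ hk, Γ.rng_mul _ _ (by rw [Γ.src_inv, hlg]), Γ.rng_inv]
    rw [Γ.mul_assoc _ _ _ (by rw [Γ.src_inv, hkg]) e,
      Γ.mul_assoc k.1 g _ hk (by rw [Γ.rng_mul _ _ (by rw [Γ.src_inv, hlg]), Γ.rng_inv]),
      Γ.mul_inv_cancel_left hlg.symm, Γ.mul_assoc _ _ _ (by rw [hk, hl']) hl])

/-- A pair `(x, χ)` of a unit `x` and a character `χ` of the isotropy group at `x`. -/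
@[ext]
structure Char where
  pt : X
  char : Γ.Isotropy pt →* Circle

/-- The action of the groupoid on pairs: `g (x, χ) = (rng g, χ (g⁻¹ · g))` when `src g = x`. -/
def act (g : G) (p : Γ.Char) (hg : Γ.src g = p.pt) : Γ.Char where
  pt := Γ.rng g
  char := p.char.comp (Γ.conjInv g hg)

/-- The set `GA` of all points `g a` with `a ∈ A` and `g` an arrow with source at `a`. -/
def saturation (A : Set Γ.Char) : Set Γ.Char :=
  {q | ∃ p ∈ A, ∃ (g : G) (hg : Γ.src g = p.pt), q = Γ.act g p hg}

/-- The set `O(U, K, V)` of the pairs `(x, χ)` with `x ∈ U` and `χ (K ∩ G_x^x) ⊆ V`. -/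
def basicSet (U : Set X) (K : Set G) (V : Set Circle) : Set Γ.Char :=
  {p | p.pt ∈ U ∧ ∀ g : Γ.Isotropy p.pt, g.1 ∈ K → p.char g ∈ V}

/-- The topology on the space of pairs with basis the finite intersections of the sets
`O(U, K, V)`, where `U` and `V` are open and `K` is a compact set of isotropy arrows. -/
instance : TopologicalSpace Γ.Char :=
  TopologicalSpace.generateFrom
    {S | ∃ (U : Set X) (K : Set G) (V : Set Circle), IsOpen U ∧ IsCompact K ∧
      (∀ g ∈ K, Γ.src g = Γ.rng g) ∧ IsOpen V ∧ S = Γ.basicSet U K V}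

/-- The convolution product `(f * ξ)(g) = ∑ f(h) ξ(h⁻¹ g)`, the sum being over all `h` with the
same range as `g`. -/
def conv (f ξ : G → ℂ) (g : G) : ℂ :=
  ∑ᶠ h ∈ {h : G | Γ.rng h = Γ.rng g}, f h * ξ (Γ.mul (Γ.inv h) g)

/-- Open bisections: open sets on which the source and the range maps are injective. -/
def IsOpenBisection (W : Set G) : Prop :=
  IsOpen W ∧ Set.InjOn Γ.src W ∧ Set.InjOn Γ.rng W

theorem conv_eq_zero {f ξ : G → ℂ} {g : G} (H : ∀ h, Γ.rng h = Γ.rng g → f h = 0) :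
    Γ.conv f ξ g = 0 :=
  finsum_mem_of_eqOn_zero fun h hh => by
    change f h * _ = 0
    rw [H h hh, zero_mul]

theorem conv_eq_single {f ξ : G → ℂ} {g k : G} (hk : Γ.rng k = Γ.rng g)
    (H : ∀ h, Γ.rng h = Γ.rng g → h ≠ k → f h = 0) :
    Γ.conv f ξ g = f k * ξ (Γ.mul (Γ.inv k) g) := by
  unfold conv
  rw [← finsum_mem_singleton (a := k) (f := fun h => f h * ξ (Γ.mul (Γ.inv h) g))]
  refine finsum_mem_inter_support_eq _ _ _ ?_
  ext h
  simp only [Set.mem_inter_iff, Set.mem_ofPred_eq, Function.mem_support, Set.mem_singleton_iff]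
  constructor
  · rintro ⟨h1, h2⟩
    refine ⟨?_, h2⟩
    by_contra hne
    exact h2 (by rw [H h h1 hne, zero_mul])
  · rintro ⟨rfl, h2⟩
    exact ⟨hk, h2⟩

theorem conv_eq_of_bisection {W : Set G} (hW : Γ.IsOpenBisection W) {f ξ : G → ℂ}
    (hf : ∀ h, h ∉ W → f h = 0) {g k : G} (hk : Γ.rng k = Γ.rng g) (hkW : k ∈ W) :
    Γ.conv f ξ g = f k * ξ (Γ.mul (Γ.inv k) g) :=
  Γ.conv_eq_single hk fun h hh hne => hf h fun hhW =>
    hne (hW.2.2 hhW hkW (hh.trans hk.symm))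

theorem conv_smul (f ξ : G → ℂ) (c : ℂ) : Γ.conv f (c • ξ) = c • Γ.conv f ξ := by
  ext g
  simp only [conv, Pi.smul_apply, smul_eq_mul]
  rw [mul_finsum_mem]
  exact finsum_mem_congr rfl fun h _ => by ring

theorem smul_conv (f ξ : G → ℂ) (c : ℂ) : Γ.conv (c • f) ξ = c • Γ.conv f ξ := by
  ext g
  simp only [conv, Pi.smul_apply, smul_eq_mul]
  rw [mul_finsum_mem]
  exact finsum_mem_congr rfl fun h _ => by ring

theorem zero_conv (ξ : G → ℂ) : Γ.conv 0 ξ = 0 := by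
  ext g
  exact Γ.conv_eq_zero fun h _ => rfl

end Algebraic

section Topological

variable (Γ : EtaleGroupoid X G)

theorem continuous_src : Continuous Γ.src := Γ.isLocalHomeomorph_src.continuous

theorem continuous_rng : Continuous Γ.rng := Γ.isLocalHomeomorph_rng.continuous

theorem unit_injective : Function.Injective Γ.unit :=
  Function.LeftInverse.injective Γ.src_unit

theorem t2Space_units (Γ : EtaleGroupoid X G) [T2Space G] : T2Space X :=
  T2Space.of_injective_continuous Γ.unit_injective Γ.continuous_unit

theorem exists_isOpenBisection (g : G) : ∃ W : Set G, Γ.IsOpenBisection W ∧ g ∈ W := by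
  obtain ⟨e, he, hes⟩ := Γ.isLocalHomeomorph_src g
  obtain ⟨e', he', her⟩ := Γ.isLocalHomeomorph_rng g
  refine ⟨e.source ∩ e'.source, ⟨e.open_source.inter e'.open_source, ?_, ?_⟩, he, he'⟩
  · rw [hes]
    exact e.injOn.mono Set.inter_subset_left
  · rw [her]
    exact e'.injOn.mono Set.inter_subset_right

theorem IsOpenBisection.mono {Γ : EtaleGroupoid X G} {W W' : Set G} (hW : Γ.IsOpenBisection W)
    (h : IsOpen W') (h' : W' ⊆ W) : Γ.IsOpenBisection W' :=
  ⟨h, hW.2.1.mono h', hW.2.2.mono h'⟩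

theorem finite_fiber [T2Space G] (f : C_c(G, ℂ)) (x : X) :
    ({h : G | Γ.rng h = x} ∩ Function.support f).Finite := by
  have := Γ.t2Space_units
  have hK : IsCompact ({h : G | Γ.rng h = x} ∩ tsupport f) :=
    IsCompact.inter_left (f.hasCompactSupport) (isClosed_singleton.preimage Γ.continuous_rng)
  refine Set.Finite.subset ?_ (Set.inter_subset_inter_right _ (subset_tsupport f))
  choose W hW hgW using Γ.exists_isOpenBisection
  obtain ⟨t, ht⟩ := hK.elim_finite_subcover W (fun g => (hW g).1)
    fun g _ => Set.mem_iUnion.2 ⟨g, hgW g⟩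
  refine Set.Finite.subset (t.finite_toSet.biUnion fun g _ =>
    (?_ : ({h : G | Γ.rng h = x} ∩ W g).Finite)) (fun h hh => ?_)
  · refine Set.Subsingleton.finite ?_
    rintro a ⟨ha, ha'⟩ b ⟨hb, hb'⟩
    exact (hW g).2.2 ha' hb' (ha.trans hb.symm)
  · obtain ⟨i, hi, hi'⟩ := Set.mem_iUnion₂.1 (ht hh)
    exact Set.mem_biUnion hi ⟨hh.1, hi'⟩

theorem finite_inter_support [T2Space G] (f : C_c(G, ℂ)) (ξ : G → ℂ) (g : G) :
    ({h : G | Γ.rng h = Γ.rng g} ∩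
      Function.support fun h => f h * ξ (Γ.mul (Γ.inv h) g)).Finite :=
  (Γ.finite_fiber f (Γ.rng g)).subset fun h hh => ⟨hh.1, fun h0 => hh.2 (by simp [h0])⟩

theorem conv_add [T2Space G] (f : C_c(G, ℂ)) (ξ η : G → ℂ) :
    Γ.conv f (ξ + η) = Γ.conv f ξ + Γ.conv f η := by
  ext g
  simp only [conv, Pi.add_apply]
  rw [← finsum_mem_add_distrib' (Γ.finite_inter_support f ξ g) (Γ.finite_inter_support f η g)]
  exact finsum_mem_congr rfl fun h _ => by ring

theorem add_conv [T2Space G] (f f' : C_c(G, ℂ)) (ξ : G → ℂ) :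
    Γ.conv (⇑f + ⇑f') ξ = Γ.conv f ξ + Γ.conv f' ξ := by
  ext g
  simp only [conv, Pi.add_apply]
  rw [← finsum_mem_add_distrib' (Γ.finite_inter_support f ξ g) (Γ.finite_inter_support f' ξ g)]
  exact finsum_mem_congr rfl fun h _ => by ring

theorem isClosed_composable [T2Space G] : IsClosed {p : G × G | Γ.src p.1 = Γ.rng p.2} := by
  have := Γ.t2Space_units
  exact isClosed_eq (Γ.continuous_src.comp continuous_fst) (Γ.continuous_rng.comp continuous_snd)

/-- Every function in `C_c(G)` is a sum of functions supported in open bisections. -/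
theorem bisection_induction [T2Space G] [LocallyCompactSpace G] (P : C_c(G, ℂ) → Prop)
    (h0 : P 0) (hadd : ∀ f f', P f → P f' → P (f + f'))
    (hbis : ∀ (f : C_c(G, ℂ)) (W : Set G), Γ.IsOpenBisection W → tsupport f ⊆ W → P f)
    (f : C_c(G, ℂ)) : P f := by
  choose W hW hgW using Γ.exists_isOpenBisection
  have hK : IsCompact (tsupport f) := f.hasCompactSupport
  obtain ⟨t, ht⟩ := hK.elim_finite_subcover W (fun g => (hW g).1)
    fun g _ => Set.mem_iUnion.2 ⟨g, hgW g⟩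
  let e := t.equivFin.symm
  obtain ⟨φ, hφ1, hφ2, -, -⟩ := exists_continuous_sum_one_of_isOpen_isCompact
    (s := fun i => W (e i).1) (fun i => (hW _).1) hK (fun g hg => by
      obtain ⟨i, hi, hi'⟩ := Set.mem_iUnion₂.1 (ht hg)
      exact Set.mem_iUnion.2 ⟨e.symm ⟨i, hi⟩, by simpa using hi'⟩)
  let F : Fin t.card → C_c(G, ℂ) := fun i =>
    ⟨⟨fun g => (φ i g : ℂ) * f g, by fun_prop⟩, f.hasCompactSupport.mul_left⟩
  have hF : f = ∑ i, F i := by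
    ext g
    rw [CompactlySupportedContinuousMap.sum_apply]
    change f g = ∑ i, (φ i g : ℂ) * f g
    rw [← Finset.sum_mul]
    by_cases hg : g ∈ tsupport f
    · have := hφ2 hg
      simp only [Finset.sum_apply, Pi.one_apply] at this
      rw [← Complex.ofReal_sum, this]
      simp
    · rw [image_eq_zero_of_notMem_tsupport hg, mul_zero]
  rw [hF]
  refine Finset.sum_induction F P (fun a b => hadd a b) h0 fun i _ => hbis _ _ (hW (e i).1) ?_
  refine subset_trans (closure_mono ?_) (hφ1 i)
  intro g hg
  exact fun h => hg (by change (φ i g : ℂ) * f g = 0; rw [h]; simp)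

theorem conv_continuous_bisection [T2Space G] (f f' : C_c(G, ℂ)) {W : Set G}
    (hW : Γ.IsOpenBisection W) (hf : tsupport f ⊆ W) : Continuous (Γ.conv f f') := by
  have := Γ.t2Space_units
  have hfW : ∀ h, h ∉ W → f h = 0 := fun h hh =>
    image_eq_zero_of_notMem_tsupport fun h' => hh (hf h')
  rw [continuous_iff_continuousAt]
  intro g
  by_cases hg : ∃ k ∈ W, Γ.rng k = Γ.rng g
  · obtain ⟨k, hkW, hk⟩ := hg
    have hop : Topology.IsOpenEmbedding (W.domRestrict Γ.rng) :=
      .of_continuous_injective_isOpenMap (Γ.continuous_rng.comp continuous_subtype_val)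
        (Set.injOn_iff_injective.1 hW.2.2)
        (Γ.isLocalHomeomorph_rng.isOpenMap.domRestrict hW.1)
    have : Nonempty W := ⟨⟨k, hkW⟩⟩
    let e := hop.toOpenPartialHomeomorph
    let σ : G → G := fun g' => (e.symm (Γ.rng g')).1
    have hU : {g' | ∃ k ∈ W, Γ.rng k = Γ.rng g'} ∈ nhds g := by
      have : {g' | ∃ k ∈ W, Γ.rng k = Γ.rng g'} = Γ.rng ⁻¹' (Γ.rng '' W) := by
        ext; simp
      rw [this]
      exact ((Γ.isLocalHomeomorph_rng.isOpenMap _ hW.1).preimage Γ.continuous_rng).mem_nhds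
        ⟨k, hkW, hk⟩
    have hσ : ∀ g', (∃ k ∈ W, Γ.rng k = Γ.rng g') → σ g' ∈ W ∧ Γ.rng (σ g') = Γ.rng g' := by
      rintro g' ⟨k', hk'W, hk'⟩
      refine ⟨(e.symm (Γ.rng g')).2, ?_⟩
      have : Γ.rng g' ∈ e.target := by
        simp only [e, Topology.IsOpenEmbedding.toOpenPartialHomeomorph_target]
        exact ⟨⟨k', hk'W⟩, hk'⟩
      exact e.right_inv this
    have hσc : ContinuousAt σ g := by
      refine continuous_subtype_val.continuousAt.comp
        (ContinuousAt.comp (f := Γ.rng) (g := e.symm) ?_ Γ.continuous_rng.continuousAt)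
      refine e.continuousAt_symm ?_
      simp only [e, Topology.IsOpenEmbedding.toOpenPartialHomeomorph_target]
      exact ⟨⟨k, hkW⟩, hk⟩
    have heq : Γ.conv f f' =ᶠ[nhds g]
        fun g' => f (σ g') * f' (Γ.mul (Γ.inv (σ g')) g') := by
      filter_upwards [hU] with g' hg'
      exact Γ.conv_eq_of_bisection hW hfW (hσ g' hg').2 (hσ g' hg').1
    rw [continuousAt_congr heq]
    refine (f.continuous.continuousAt.comp hσc).mul ?_
    refine f'.continuous.continuousAt.comp ?_
    have h1 : ContinuousWithinAt (fun p : G × G => Γ.mul p.1 p.2)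
        {p | Γ.src p.1 = Γ.rng p.2} (Γ.inv (σ g), g) :=
      Γ.continuousOn_mul _ (by
        change Γ.src (Γ.inv (σ g)) = Γ.rng g
        rw [Γ.src_inv, (hσ g ⟨k, hkW, hk⟩).2])
    have h2 : Filter.Tendsto (fun g' => (Γ.inv (σ g'), g')) (nhds g)
        (nhdsWithin (Γ.inv (σ g), g) {p | Γ.src p.1 = Γ.rng p.2}) := by
      refine tendsto_nhdsWithin_iff.2 ⟨?_, ?_⟩
      · exact (ContinuousAt.prodMk (Γ.continuous_inv.continuousAt.comp hσc) continuousAt_id)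
      · filter_upwards [hU] with g' hg'
        rw [Γ.src_inv, (hσ g' hg').2]
    exact Filter.Tendsto.comp h1 h2
  · have hC : IsClosed (Γ.rng ⁻¹' (Γ.rng '' tsupport f)) :=
      (IsCompact.image f.hasCompactSupport Γ.continuous_rng).isClosed.preimage Γ.continuous_rng
    have hmem : (Γ.rng ⁻¹' (Γ.rng '' tsupport f))ᶜ ∈ nhds g := by
      refine hC.isOpen_compl.mem_nhds ?_
      rintro ⟨k, hk, hk'⟩
      exact hg ⟨k, hf hk, hk'⟩
    have heq : Γ.conv f f' =ᶠ[nhds g] fun _ => 0 := by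
      filter_upwards [hmem] with g' hg'
      refine Γ.conv_eq_zero fun h hh => image_eq_zero_of_notMem_tsupport fun h' => hg' ?_
      exact ⟨h, h', hh⟩
    rw [continuousAt_congr heq]
    exact continuousAt_const

theorem conv_continuous [T2Space G] [LocallyCompactSpace G] (f f' : C_c(G, ℂ)) :
    Continuous (Γ.conv f f') := by
  refine Γ.bisection_induction (fun f => Continuous (Γ.conv f f')) ?_ ?_ ?_ f
  · rw [CompactlySupportedContinuousMap.coe_zero, zero_conv]
    exact continuous_zero
  · intro f₁ f₂ h₁ h₂
    rw [CompactlySupportedContinuousMap.coe_add, add_conv]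
    exact h₁.add h₂
  · intro f₁ W hW hf
    exact Γ.conv_continuous_bisection f₁ f' hW hf

theorem conv_hasCompactSupport [T2Space G] (f f' : C_c(G, ℂ)) :
    HasCompactSupport (Γ.conv f f') := by
  have hK : IsCompact ((tsupport f ×ˢ tsupport f') ∩ {p : G × G | Γ.src p.1 = Γ.rng p.2}) :=
    (IsCompact.prod f.hasCompactSupport f'.hasCompactSupport).inter_right Γ.isClosed_composable
  refine HasCompactSupport.intro (hK.image_of_continuousOn
    (Γ.continuousOn_mul.mono Set.inter_subset_right)) fun g hg => ?_
  refine finsum_mem_of_eqOn_zero fun h hh => ?_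
  change f h * f' (Γ.mul (Γ.inv h) g) = 0
  by_contra hne
  have h1 := left_ne_zero_of_mul hne
  have h2 := right_ne_zero_of_mul hne
  refine hg ⟨(h, Γ.mul (Γ.inv h) g), ⟨⟨subset_tsupport _ h1, subset_tsupport _ h2⟩, ?_⟩, ?_⟩
  · change Γ.src h = Γ.rng _
    rw [Γ.rng_mul _ _ ((Γ.src_inv h).trans hh), Γ.rng_inv]
  · exact Γ.mul_inv_cancel_left hh

theorem conv_conv [T2Space G] [LocallyCompactSpace G] (f f' : C_c(G, ℂ)) (ξ : G → ℂ) :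
    Γ.conv (Γ.conv f f') ξ = Γ.conv f (Γ.conv f' ξ) := by
  let m : C_c(G, ℂ) → C_c(G, ℂ) := fun f =>
    ⟨⟨Γ.conv f f', Γ.conv_continuous f f'⟩, Γ.conv_hasCompactSupport f f'⟩
  refine Γ.bisection_induction
    (fun f => Γ.conv (Γ.conv f f') ξ = Γ.conv f (Γ.conv f' ξ)) ?_ ?_ ?_ f
  · simp only [CompactlySupportedContinuousMap.coe_zero, zero_conv]
  · intro f₁ f₂ h₁ h₂
    simp only [CompactlySupportedContinuousMap.coe_add, add_conv]
    rw [← h₁, ← h₂]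
    exact Γ.add_conv (m f₁) (m f₂) ξ
  · intro f W hW hf
    have hfW : ∀ h, h ∉ W → f h = 0 := fun h hh =>
      image_eq_zero_of_notMem_tsupport fun h' => hh (hf h')
    ext g
    by_cases hg : ∃ k ∈ W, Γ.rng k = Γ.rng g
    · obtain ⟨k, hkW, hk⟩ := hg
      rw [Γ.conv_eq_of_bisection hW hfW hk hkW]
      have hk' : Γ.src (Γ.inv k) = Γ.rng g := (Γ.src_inv k).trans hk
      unfold conv
      rw [mul_finsum_mem]
      refine finsum_mem_eq_of_bijOn (fun h => Γ.mul (Γ.inv k) h) ⟨?_, ?_, ?_⟩ ?_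
      · intro h hh
        change Γ.rng (Γ.mul (Γ.inv k) h) = Γ.rng (Γ.mul (Γ.inv k) g)
        have hh : Γ.rng h = Γ.rng g := hh
        rw [Γ.rng_mul _ _ (hk'.trans hh.symm), Γ.rng_mul _ _ hk']
      · intro a ha b hb hab
        exact Γ.mul_left_cancel (hk'.trans (Eq.symm ha)) (hk'.trans (Eq.symm hb)) hab
      · intro l hl
        have hl : Γ.rng l = Γ.rng (Γ.mul (Γ.inv k) g) := hl
        rw [Γ.rng_mul _ _ hk', Γ.rng_inv] at hl
        refine ⟨Γ.mul k l, ?_, Γ.inv_mul_cancel_left hl.symm⟩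
        change Γ.rng (Γ.mul k l) = Γ.rng g
        rw [Γ.rng_mul _ _ hl.symm, hk]
      · intro h hh
        have hh : Γ.rng h = Γ.rng g := hh
        have h3 := Γ.conv_eq_of_bisection hW hfW (ξ := f') (hk.trans hh.symm) hkW
        unfold conv at h3
        rw [h3, _root_.mul_assoc]
        congr 3
        rw [Γ.mul_inv_rev (hk'.trans hh.symm), Γ.inv_inv,
          Γ.mul_assoc _ _ _ (by rw [Γ.src_inv, hk, hh])
            (by rw [Γ.rng_mul _ _ hk', Γ.rng_inv]),
          Γ.mul_inv_cancel_left hk]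
    · rw [Γ.conv_eq_zero (f := f) fun h hh => hfW h fun h' => hg ⟨h, h', hh⟩]
      refine Γ.conv_eq_zero fun k hk => Γ.conv_eq_zero fun h hh => hfW h fun h' => hg ?_
      exact ⟨h, h', hh.trans hk⟩

end Topological

section Algebra

variable [T2Space G] [LocallyCompactSpace G]

/-- The convolution algebra: the space `C_c(G)` of continuous compactly supported functions with
the convolution product and the involution `f^*(g) = conj (f(g⁻¹))`. -/
def ConvAlg (_Γ : EtaleGroupoid X G) : Type u := C_c(G, ℂ)

variable {Γ : EtaleGroupoid X G}

instance : FunLike Γ.ConvAlg G ℂ := inferInstanceAs (FunLike C_c(G, ℂ) G ℂ)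
instance : AddCommGroup Γ.ConvAlg := inferInstanceAs (AddCommGroup C_c(G, ℂ))
instance : Module ℂ Γ.ConvAlg := inferInstanceAs (Module ℂ C_c(G, ℂ))

instance : Mul Γ.ConvAlg where
  mul f f' :=
    (⟨⟨Γ.conv f f', Γ.conv_continuous f f'⟩, Γ.conv_hasCompactSupport f f'⟩ : C_c(G, ℂ))

instance : Star Γ.ConvAlg where
  star f := (⟨⟨fun g => star (f (Γ.inv g)),
      continuous_star.comp (f.continuous.comp Γ.continuous_inv)⟩, by
    have h : HasCompactSupport (fun g => f (Γ.inv g)) :=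
      HasCompactSupport.intro (K := Γ.inv ⁻¹' tsupport f)
        (by
          have : Γ.inv ⁻¹' tsupport f = Γ.inv '' tsupport f := by
            ext g
            constructor
            · intro hg
              exact ⟨_, hg, Γ.inv_inv g⟩
            · rintro ⟨k, hk, rfl⟩
              change Γ.inv (Γ.inv k) ∈ tsupport f
              rw [Γ.inv_inv]
              exact hk
          rw [this]
          exact IsCompact.image f.hasCompactSupport Γ.continuous_inv)
        fun g hg => image_eq_zero_of_notMem_tsupport hg
    exact h.comp_left (g := star) (star_zero ℂ)⟩ : C_c(G, ℂ))

namespace ConvAlg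

@[ext]
theorem ext {f f' : Γ.ConvAlg} (h : ∀ g, f g = f' g) : f = f' :=
  CompactlySupportedContinuousMap.ext h

theorem coe_zero : ⇑(0 : Γ.ConvAlg) = 0 := rfl
theorem coe_add (f f' : Γ.ConvAlg) : ⇑(f + f') = ⇑f + ⇑f' := rfl
theorem coe_smul (c : ℂ) (f : Γ.ConvAlg) : ⇑(c • f) = c • ⇑f := rfl
theorem coe_mul (f f' : Γ.ConvAlg) : ⇑(f * f') = Γ.conv f f' := rfl
theorem star_apply (f : Γ.ConvAlg) (g : G) : (star f) g = star (f (Γ.inv g)) := rfl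

theorem continuous (f : Γ.ConvAlg) : Continuous f :=
  (show C_c(G, ℂ) from f).continuous

theorem hasCompactSupport (f : Γ.ConvAlg) : HasCompactSupport f :=
  CompactlySupportedContinuousMap.hasCompactSupport' f

theorem conv_add' (f : Γ.ConvAlg) (ξ η : G → ℂ) :
    Γ.conv f (ξ + η) = Γ.conv f ξ + Γ.conv f η :=
  Γ.conv_add (show C_c(G, ℂ) from f) ξ η

theorem add_conv' (f f' : Γ.ConvAlg) (ξ : G → ℂ) :
    Γ.conv (⇑(f + f')) ξ = Γ.conv f ξ + Γ.conv f' ξ :=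
  Γ.add_conv (show C_c(G, ℂ) from f) (show C_c(G, ℂ) from f') ξ

theorem mul_conv (f f' : Γ.ConvAlg) (ξ : G → ℂ) :
    Γ.conv (⇑(f * f')) ξ = Γ.conv f (Γ.conv f' ξ) :=
  Γ.conv_conv (show C_c(G, ℂ) from f) (show C_c(G, ℂ) from f') ξ

theorem induction (P : Γ.ConvAlg → Prop)
    (h0 : P 0) (hadd : ∀ f f', P f → P f' → P (f + f'))
    (hbis : ∀ (f : Γ.ConvAlg) (W : Set G), Γ.IsOpenBisection W → tsupport f ⊆ W → P f)
    (f : Γ.ConvAlg) : P f :=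
  Γ.bisection_induction P h0 hadd hbis f

end ConvAlg

instance : NonUnitalRing Γ.ConvAlg where
  left_distrib f f' f'' := by
    apply DFunLike.coe_injective
    simp only [ConvAlg.coe_mul, ConvAlg.coe_add, ConvAlg.conv_add']
  right_distrib f f' f'' := by
    apply DFunLike.coe_injective
    rw [ConvAlg.coe_add, ConvAlg.coe_mul, ConvAlg.add_conv']
    rfl
  zero_mul f := by
    apply DFunLike.coe_injective
    rw [ConvAlg.coe_mul, ConvAlg.coe_zero, zero_conv]
  mul_zero f := by
    apply DFunLike.coe_injective
    have := Γ.conv_smul f 0 0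
    simpa [ConvAlg.coe_mul, ConvAlg.coe_zero] using this
  mul_assoc f f' f'' := by
    apply DFunLike.coe_injective
    rw [ConvAlg.coe_mul, ConvAlg.mul_conv, ConvAlg.coe_mul, ConvAlg.coe_mul]

instance : IsScalarTower ℂ Γ.ConvAlg Γ.ConvAlg where
  smul_assoc c f f' := by
    apply DFunLike.coe_injective
    simp only [smul_eq_mul, ConvAlg.coe_mul, ConvAlg.coe_smul, smul_conv]

instance : SMulCommClass ℂ Γ.ConvAlg Γ.ConvAlg where
  smul_comm c f f' := by
    apply DFunLike.coe_injective
    simp only [smul_eq_mul, ConvAlg.coe_mul, ConvAlg.coe_smul, conv_smul]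

instance : StarRing Γ.ConvAlg where
  star_involutive f := by
    ext g
    simp only [ConvAlg.star_apply, Γ.inv_inv, star_star]
  star_add f f' := by
    ext g
    simp only [ConvAlg.star_apply, ConvAlg.coe_add, Pi.add_apply, star_add]
  star_mul f f' := by
    ext g
    rw [ConvAlg.star_apply, ConvAlg.coe_mul, ConvAlg.coe_mul]
    unfold conv
    have hfin := Γ.finite_inter_support (show C_c(G, ℂ) from f) f' (Γ.inv g)
    have key : ∀ (s : Set G) (F : G → ℂ),
        star (∑ᶠ h ∈ s, F h) = ∑ᶠ h ∈ s, star (F h) := by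
      intro s F
      have h1 := AddEquiv.map_finsum (starAddEquiv (R := ℂ)) (fun h => ∑ᶠ (_ : h ∈ s), F h)
      have h2 := fun h => AddEquiv.map_finsum (starAddEquiv (R := ℂ)) (fun (_ : h ∈ s) => F h)
      simp only [starAddEquiv_apply] at h1 h2
      rw [h1]
      exact finsum_congr h2
    rw [key]
    symm
    refine finsum_mem_eq_of_bijOn (fun h => Γ.mul (Γ.inv g) h) ⟨?_, ?_, ?_⟩ ?_
    · intro h hh
      change Γ.rng (Γ.mul (Γ.inv g) h) = Γ.rng (Γ.inv g)
      exact Γ.rng_mul _ _ ((Γ.src_inv g).trans (Eq.symm hh))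
    · intro a ha b hb hab
      exact Γ.mul_left_cancel ((Γ.src_inv g).trans (Eq.symm ha))
        ((Γ.src_inv g).trans (Eq.symm hb)) hab
    · intro l hl
      have hl : Γ.rng l = Γ.rng (Γ.inv g) := hl
      rw [Γ.rng_inv] at hl
      exact ⟨Γ.mul g l, Γ.rng_mul _ _ hl.symm, Γ.inv_mul_cancel_left hl.symm⟩
    · intro h hh
      have hh : Γ.rng h = Γ.rng g := hh
      have e : Γ.src (Γ.inv g) = Γ.rng h := (Γ.src_inv g).trans hh.symm
      have e' : Γ.src (Γ.inv h) = Γ.rng g := (Γ.src_inv h).trans hh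
      rw [ConvAlg.star_apply, ConvAlg.star_apply, star_mul, Γ.mul_inv_rev e',
        Γ.mul_inv_rev e, Γ.inv_inv, Γ.inv_inv]
      congr 3
      rw [Γ.mul_assoc _ _ _ e' (Γ.rng_inv g).symm, Γ.mul_inv, ← hh, ← Γ.src_inv, Γ.mul_unit]

instance : StarModule ℂ Γ.ConvAlg where
  star_smul c f := by
    ext g
    simp only [ConvAlg.star_apply, ConvAlg.coe_smul, Pi.smul_apply, star_smul]

section Bounds

theorem IsOpenBisection.inv {W : Set G} (hW : Γ.IsOpenBisection W) :
    Γ.IsOpenBisection (Γ.inv ⁻¹' W) := by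
  have hinj : Function.Injective Γ.inv := Function.LeftInverse.injective Γ.inv_inv
  refine ⟨hW.1.preimage Γ.continuous_inv, ?_, ?_⟩
  · intro a ha b hb hab
    exact hinj (hW.2.2 ha hb (by rw [Γ.rng_inv, Γ.rng_inv, hab]))
  · intro a ha b hb hab
    exact hinj (hW.2.1 ha hb (by rw [Γ.src_inv, Γ.src_inv, hab]))

theorem eq_zero_of_notMem {f : Γ.ConvAlg} {W : Set G} (hf : tsupport f ⊆ W) {h : G}
    (hh : h ∉ W) : f h = 0 :=
  image_eq_zero_of_notMem_tsupport fun h' => hh (hf h')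

theorem star_mul_self_apply {f : Γ.ConvAlg} {W : Set G} (hW : Γ.IsOpenBisection W)
    (hf : tsupport f ⊆ W) {M : ℝ} (hM : ∀ g, ‖f g‖ ≤ M) (g : G) :
    ∃ t : ℝ, 0 ≤ t ∧ t ≤ M ^ 2 ∧ (star f * f) g = t ∧ (t ≠ 0 → g = Γ.unit (Γ.rng g)) := by
  have h0 : ∀ h, h ∉ Γ.inv ⁻¹' W → (star f) h = 0 := fun h hh => by
    rw [ConvAlg.star_apply, eq_zero_of_notMem hf hh, star_zero]
  by_cases hg : ∃ k ∈ Γ.inv ⁻¹' W, Γ.rng k = Γ.rng g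
  · obtain ⟨k, hkW, hk⟩ := hg
    have e : Γ.src (Γ.inv k) = Γ.rng g := (Γ.src_inv k).trans hk
    have h1 := Γ.conv_eq_of_bisection hW.inv h0 (ξ := f) hk hkW
    rw [← ConvAlg.coe_mul, ConvAlg.star_apply] at h1
    by_cases h2 : f (Γ.mul (Γ.inv k) g) = 0
    · refine ⟨0, le_rfl, by positivity, ?_, fun h => absurd rfl h⟩
      rw [h1, h2]
      simp
    · have h3 : Γ.mul (Γ.inv k) g ∈ W := by
        by_contra h
        exact h2 (eq_zero_of_notMem hf h)
      have h4 : Γ.mul (Γ.inv k) g = Γ.inv k := hW.2.2 h3 hkW (Γ.rng_mul _ _ e)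
      refine ⟨‖f (Γ.inv k)‖ ^ 2, by positivity,
        pow_le_pow_left₀ (norm_nonneg _) (hM _) 2, ?_, fun _ => ?_⟩
      · rw [h1, h4]
        simpa using Complex.conj_mul' (f (Γ.inv k))
      · have h5 := Γ.mul_unit (Γ.inv k)
        rw [e] at h5
        exact Γ.mul_left_cancel e (e.trans (Γ.rng_unit _).symm) (h4.trans h5.symm)
  · refine ⟨0, le_rfl, by positivity, ?_, fun h => absurd rfl h⟩
    rw [ConvAlg.coe_mul]
    simpa using Γ.conv_eq_zero fun h hh => h0 h fun h' => hg ⟨h, h', hh⟩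

theorem norm_rep_apply_le {H : Type*} [NormedAddCommGroup H] [InnerProductSpace ℂ H]
    [CompleteSpace H] (ρ : Γ.ConvAlg →⋆ₙₐ[ℂ] (H →L[ℂ] H)) {f : Γ.ConvAlg} {W : Set G}
    (hW : Γ.IsOpenBisection W) (hf : tsupport f ⊆ W) {M : ℝ} (hM0 : 0 ≤ M)
    (hM : ∀ g, ‖f g‖ ≤ M) (ξ : H) : ‖ρ f ξ‖ ≤ M * ‖ξ‖ := by
  choose t ht0 htM hta htu using star_mul_self_apply hW hf hM
  let φ : C(ℂ, ℂ) := ⟨fun z => ((M - Real.sqrt (M ^ 2 - z.re) : ℝ) : ℂ), by fun_prop⟩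
  have hφ0 : φ 0 = 0 := by
    simp [φ, Real.sqrt_sq hM0]
  let b : Γ.ConvAlg := (show C_c(G, ℂ) from star f * f).compLeft φ
  have hb : ∀ g, b g = ((M - Real.sqrt (M ^ 2 - t g) : ℝ) : ℂ) := fun g => by
    have : b g = φ ((star f * f) g) := CompactlySupportedContinuousMap.compLeft_apply hφ0 _ g
    rw [this, hta]
    simp [φ]
  have hbu : ∀ g, b g ≠ 0 → g = Γ.unit (Γ.rng g) := fun g hg => htu g fun h => hg (by
    rw [hb, h, sub_zero, Real.sqrt_sq hM0]
    simp)
  have hbb : ∀ g, (b * b) g = b (Γ.unit (Γ.rng g)) * b g := fun g => by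
    rw [ConvAlg.coe_mul, Γ.conv_eq_single (k := Γ.unit (Γ.rng g)) (Γ.rng_unit _), Γ.inv_unit,
      Γ.unit_mul]
    intro h hh hne
    by_contra h0
    exact hne ((hbu h h0).trans (by rw [hh]))
  have hstar : star b = b := by
    ext g
    have hreal : ∀ g, star (b g) = b g := fun g => by
      rw [hb]
      exact Complex.conj_ofReal _
    rw [ConvAlg.star_apply, hreal]
    by_cases h1 : b g = 0
    · by_contra h2
      have h3 := hbu _ (fun h => h2 (h.trans h1.symm))
      have h4 : g = Γ.inv g := by
        have := congrArg Γ.inv h3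
        rw [Γ.inv_inv, Γ.inv_unit, ← h3] at this
        exact this
      exact h2 (by rw [← h4])
    · have h3 := hbu _ h1
      have h4 : Γ.inv g = g := by
        have := congrArg Γ.inv h3
        rw [Γ.inv_unit, ← h3] at this
        exact this
      rw [h4]
  have hkey : (2 * M : ℂ) • b - b * b = star f * f := by
    have : (2 * M : ℂ) • b = star f * f + b * b := by
      ext g
      rw [ConvAlg.coe_add, ConvAlg.coe_smul, Pi.add_apply, Pi.smul_apply, hbb, hta, smul_eq_mul]
      by_cases h1 : b g = 0
      · have h2 : t g = 0 := by
          rw [hb] at h1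
          have h3 : M - Real.sqrt (M ^ 2 - t g) = 0 := by exact_mod_cast h1
          have h4 := Real.sq_sqrt (sub_nonneg.2 (htM g))
          rw [← sub_eq_zero.1 h3] at h4
          linarith
        rw [h1, h2]
        simp
      · rw [← hbu g h1, hb]
        have h4 := Real.sq_sqrt (sub_nonneg.2 (htM g))
        norm_cast
        nlinarith
    rw [this, add_sub_cancel_right]
  have hB : ContinuousLinearMap.adjoint (ρ b) = ρ b := by
    have := map_star ρ b
    rw [hstar] at this
    exact this.symm
  have hsym : ∀ x y : H, ⟪ρ b x, y⟫_ℂ = ⟪x, ρ b y⟫_ℂ := fun x y => by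
    conv_rhs => rw [← hB]
    exact (ContinuousLinearMap.adjoint_inner_right (ρ b) x y).symm
  have h1 : ⟪ρ b ξ, ρ b ξ⟫_ℂ = ⟪ρ (b * b) ξ, ξ⟫_ℂ := by
    rw [map_mul, mul_apply_eq_comp]
    exact (hsym _ _).symm
  have h2 : ⟪ρ f ξ, ρ f ξ⟫_ℂ = ⟪ρ (star f * f) ξ, ξ⟫_ℂ := by
    rw [map_mul, mul_apply_eq_comp, map_star]
    exact (ContinuousLinearMap.adjoint_inner_left (ρ f) ξ (ρ f ξ)).symm
  have h3 : ‖(M : ℂ) • ξ - ρ b ξ‖ ^ 2 = M ^ 2 * ‖ξ‖ ^ 2 - ‖ρ f ξ‖ ^ 2 := by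
    rw [@norm_sub_sq ℂ, norm_smul, ← @inner_self_eq_norm_sq ℂ _ _ _ _ (ρ b ξ),
      ← @inner_self_eq_norm_sq ℂ _ _ _ _ (ρ f ξ), h1, h2, ← hkey, map_sub, map_smul,
      sub_apply, smul_apply, inner_sub_left, inner_smul_left, inner_smul_left, hsym ξ ξ]
    simp [abs_of_nonneg hM0]
    ring_nf
  have h4 : ‖ρ f ξ‖ ^ 2 ≤ (M * ‖ξ‖) ^ 2 := by
    rw [mul_pow]
    nlinarith [sq_nonneg ‖(M : ℂ) • ξ - ρ b ξ‖]
  exact le_of_sq_le_sq h4 (by positivity)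

theorem ConvAlg.exists_norm_le (f : Γ.ConvAlg) : ∃ M : ℝ, 0 ≤ M ∧ ∀ g, ‖f g‖ ≤ M := by
  obtain ⟨M, hM⟩ := f.continuous.bounded_above_of_compact_support f.hasCompactSupport
  exact ⟨max M 0, le_max_right _ _, fun g => (hM g).trans (le_max_left _ _)⟩

end Bounds

/-- A representation of the convolution algebra `C_c(G)` by bounded operators on a Hilbert space.
Hilbert spaces in the universe of `G` suffice: the norm `‖π(f)‖` is attained as a supremum over
cyclic subrepresentations, whose spaces are completions of quotients of `C_c(G)`. -/
structure Rep (Γ : EtaleGroupoid X G) : Type (u + 1) where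
  H : Type u
  [normedAddCommGroup : NormedAddCommGroup H]
  [innerProductSpace : InnerProductSpace ℂ H]
  [completeSpace : CompleteSpace H]
  hom : Γ.ConvAlg →⋆ₙₐ[ℂ] (H →L[ℂ] H)

attribute [instance] Rep.normedAddCommGroup Rep.innerProductSpace Rep.completeSpace

theorem exists_rep_bound (f : Γ.ConvAlg) : ∃ C : ℝ, ∀ ρ : Γ.Rep, ‖ρ.hom f‖ ≤ C := by
  refine ConvAlg.induction (fun f => ∃ C : ℝ, ∀ ρ : Γ.Rep, ‖ρ.hom f‖ ≤ C) ?_ ?_ ?_ f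
  · exact ⟨0, fun ρ => by rw [map_zero, norm_zero]⟩
  · rintro f f' ⟨C, hC⟩ ⟨C', hC'⟩
    refine ⟨C + C', fun ρ => ?_⟩
    rw [map_add]
    exact (norm_add_le _ _).trans (add_le_add (hC ρ) (hC' ρ))
  · intro f W hW hf
    obtain ⟨M, hM0, hM⟩ := f.exists_norm_le
    exact ⟨M, fun ρ => ContinuousLinearMap.opNorm_le_bound _ hM0
      (norm_rep_apply_le ρ.hom hW hf hM0 hM)⟩

/-- The bounded families of operators indexed by all representations of `C_c(G)`. -/
def RepProd (Γ : EtaleGroupoid X G) : Type (u + 1) :=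
  lp (fun ρ : Γ.Rep => ρ.H →L[ℂ] ρ.H) ∞

/-- The supremum norm and the pointwise operations make this a C*-algebra. -/
instance : NonUnitalCStarAlgebra Γ.RepProd :=
  inferInstanceAs (NonUnitalCStarAlgebra (lp (fun ρ : Γ.Rep => ρ.H →L[ℂ] ρ.H) ∞))

/-- The evaluation of a bounded family at one representation. -/
def RepProd.eval (ρ : Γ.Rep) : Γ.RepProd →⋆ₙₐ[ℂ] (ρ.H →L[ℂ] ρ.H) where
  toFun := fun (a : lp (fun ρ : Γ.Rep => ρ.H →L[ℂ] ρ.H) ∞) => a ρ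
  map_smul' _ _ := rfl
  map_zero' := rfl
  map_add' _ _ := rfl
  map_mul' _ _ := rfl
  map_star' _ := rfl

/-- The *-homomorphism `f ↦ (π(f))_π`. -/
def toRepProd (Γ : EtaleGroupoid X G) : Γ.ConvAlg →⋆ₙₐ[ℂ] Γ.RepProd where
  toFun f := (⟨fun ρ => ρ.hom f, memℓp_infty (by
    obtain ⟨C, hC⟩ := exists_rep_bound f
    exact ⟨C, by rintro _ ⟨ρ, rfl⟩; exact hC ρ⟩)⟩ : lp (fun ρ : Γ.Rep => ρ.H →L[ℂ] ρ.H) ∞)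
  map_smul' c f := Subtype.ext (funext fun ρ => map_smul ρ.hom c f)
  map_zero' := Subtype.ext (funext fun ρ => map_zero ρ.hom)
  map_add' f f' := Subtype.ext (funext fun ρ => map_add ρ.hom f f')
  map_mul' f f' := Subtype.ext (funext fun ρ => map_mul ρ.hom f f')
  map_star' f := Subtype.ext (funext fun ρ => map_star ρ.hom f)

theorem norm_toRepProd (f : Γ.ConvAlg) : ‖Γ.toRepProd f‖ = ⨆ ρ : Γ.Rep, ‖ρ.hom f‖ :=
  lp.norm_eq_ciSup (show lp (fun ρ : Γ.Rep => ρ.H →L[ℂ] ρ.H) ∞ from Γ.toRepProd f)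

/-- The closure of the image of `C_c(G)` in the bounded families of operators. -/
def cstarSubalgebra (Γ : EtaleGroupoid X G) : NonUnitalStarSubalgebra ℂ Γ.RepProd :=
  (NonUnitalStarAlgHom.range Γ.toRepProd).topologicalClosure

/-- The full groupoid C*-algebra `C*(G)`: the completion of `C_c(G)` in the norm
`‖f‖ = sup_π ‖π(f)‖`, realized as the closure of the image of `C_c(G)` under the (isometric for this
norm) map `f ↦ (π(f))_π` into the complete space of bounded families of operators. -/
def CStar (Γ : EtaleGroupoid X G) : Type (u + 1) := Γ.cstarSubalgebra

instance : IsClosed (Γ.cstarSubalgebra : Set Γ.RepProd) :=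
  NonUnitalStarSubalgebra.isClosed_topologicalClosure _

instance : NonUnitalCStarAlgebra Γ.CStar :=
  inferInstanceAs (NonUnitalCStarAlgebra Γ.cstarSubalgebra)

/-- The canonical homomorphism `C_c(G) → C*(G)`. -/
def toCStar (Γ : EtaleGroupoid X G) : Γ.ConvAlg →⋆ₙₐ[ℂ] Γ.CStar where
  toFun f := (⟨Γ.toRepProd f, NonUnitalStarSubalgebra.le_topologicalClosure _ ⟨f, rfl⟩⟩ :
    Γ.cstarSubalgebra)
  map_smul' c f := Subtype.ext (map_smul Γ.toRepProd c f)
  map_zero' := Subtype.ext (map_zero Γ.toRepProd)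
  map_add' f f' := Subtype.ext (map_add Γ.toRepProd f f')
  map_mul' f f' := Subtype.ext (map_mul Γ.toRepProd f f')
  map_star' f := Subtype.ext (map_star Γ.toRepProd f)

theorem norm_toCStar (f : Γ.ConvAlg) : ‖Γ.toCStar f‖ = ⨆ ρ : Γ.Rep, ‖ρ.hom f‖ :=
  norm_toRepProd f

theorem denseRange_toCStar : DenseRange Γ.toCStar := by
  have key : ∀ a : Γ.cstarSubalgebra, a ∈ closure (Set.range fun f =>
      (⟨Γ.toRepProd f, NonUnitalStarSubalgebra.le_topologicalClosure _ ⟨f, rfl⟩⟩ :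
        Γ.cstarSubalgebra)) := by
    intro a
    rw [closure_subtype, ← Set.range_comp]
    have h : Set.range (Subtype.val ∘ fun f : Γ.ConvAlg =>
        (⟨Γ.toRepProd f, NonUnitalStarSubalgebra.le_topologicalClosure _ ⟨f, rfl⟩⟩ :
          Γ.cstarSubalgebra)) =
        (NonUnitalStarAlgHom.range Γ.toRepProd : Set Γ.RepProd) := by
      ext x
      exact Iff.rfl
    rw [h]
    exact a.2
  exact key

/-- The extension of a representation of `C_c(G)` to `C*(G)`. -/
def Rep.ext (ρ : Γ.Rep) : Γ.CStar →⋆ₙₐ[ℂ] (ρ.H →L[ℂ] ρ.H) where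
  toFun := fun (a : Γ.cstarSubalgebra) => RepProd.eval ρ a.1
  map_smul' _ _ := rfl
  map_zero' := rfl
  map_add' _ _ := rfl
  map_mul' _ _ := rfl
  map_star' _ := rfl

theorem Rep.ext_toCStar (ρ : Γ.Rep) (f : Γ.ConvAlg) : ρ.ext (Γ.toCStar f) = ρ.hom f := rfl

section Induced

/-- The orbit `[x] = rng (G_x)` of `x`. The range map identifies it with `G_x / G_x^x`. -/
def Orbit (Γ : EtaleGroupoid X G) (x : X) : Type u := {z : X // ∃ g, Γ.src g = x ∧ Γ.rng g = z}

/-- A choice of an arrow from `x` to the point `z` of its orbit, that is, of a representative of the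
class in `G_x / G_x^x` that corresponds to `z`. -/
def Orbit.rep {x : X} (z : Γ.Orbit x) : G := z.2.choose

theorem Orbit.src_rep {x : X} (z : Γ.Orbit x) : Γ.src z.rep = x := z.2.choose_spec.1

theorem Orbit.rng_rep {x : X} (z : Γ.Orbit x) : Γ.rng z.rep = z.1 := z.2.choose_spec.2

/-- The isotropy element `a⁻¹ b`. -/
def ratio {x : X} {a b : G} (ha : Γ.src a = x) (hb : Γ.src b = x)
    (h : Γ.rng a = Γ.rng b) : Γ.Isotropy x :=
  ⟨Γ.mul (Γ.inv a) b, by rw [Γ.src_mul _ _ ((Γ.src_inv a).trans h), hb],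
    by rw [Γ.rng_mul _ _ ((Γ.src_inv a).trans h), Γ.rng_inv, ha]⟩

theorem mul_ratio {x : X} {a b : G} (ha : Γ.src a = x) (hb : Γ.src b = x)
    (h : Γ.rng a = Γ.rng b) : Γ.mul a (ratio ha hb h).1 = b :=
  Γ.mul_inv_cancel_left h

/-- The functions `ξ` on `G_x` (extended by zero to `G`) such that `ξ(gh) = conj (χ(h)) ξ(g)` for
`g ∈ G_x` and `h ∈ G_x^x`, and such that the sum of `‖ξ(g)‖²` over `g ∈ G_x / G_x^x` is finite. -/
def indSubmodule (p : Γ.Char) : Submodule ℂ (G → ℂ) where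
  carrier := {ξ | (∀ g, Γ.src g ≠ p.pt → ξ g = 0) ∧
    (∀ (g : G) (h : Γ.Isotropy p.pt), Γ.src g = p.pt →
      ξ (Γ.mul g h.1) = star (p.char h : ℂ) * ξ g) ∧
    Summable fun z : Γ.Orbit p.pt => ‖ξ z.rep‖ ^ 2}
  zero_mem' := ⟨fun _ _ => rfl, fun _ _ _ => by simp, by simp⟩
  add_mem' := by
    rintro ξ η ⟨h1, h2, h3⟩ ⟨h1', h2', h3'⟩
    refine ⟨fun g hg => ?_, fun g h hg => ?_, ?_⟩
    · rw [Pi.add_apply, h1 g hg, h1' g hg, add_zero]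
    · rw [Pi.add_apply, h2 g h hg, h2' g h hg, Pi.add_apply, mul_add]
    · refine Summable.of_nonneg_of_le (fun _ => by positivity) (fun z => ?_)
        ((h3.add h3').mul_left 2)
      have h4 := norm_add_le (ξ z.rep) (η z.rep)
      have h5 := norm_nonneg (ξ z.rep + η z.rep)
      rw [Pi.add_apply]
      nlinarith [sq_nonneg (‖ξ z.rep‖ - ‖η z.rep‖)]
  smul_mem' := by
    rintro c ξ ⟨h1, h2, h3⟩
    refine ⟨fun g hg => ?_, fun g h hg => ?_, ?_⟩
    · rw [Pi.smul_apply, h1 g hg, smul_zero]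
    · rw [Pi.smul_apply, h2 g h hg, Pi.smul_apply, smul_eq_mul, smul_eq_mul]
      ring
    · simpa [mul_pow] using h3.mul_left (‖c‖ ^ 2)

/-- The space of the representation of `C*(G)` induced by `χ`, where `p = (x, χ)`. -/
def IndSpace (p : Γ.Char) : Type u := indSubmodule p

namespace IndSpace

variable {p : Γ.Char}

instance : AddCommGroup (IndSpace p) := inferInstanceAs (AddCommGroup (indSubmodule p))
instance : Module ℂ (IndSpace p) := inferInstanceAs (Module ℂ (indSubmodule p))

instance : FunLike (IndSpace p) G ℂ where
  coe := fun (ξ : indSubmodule p) => ξ.1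
  coe_injective := Subtype.val_injective

theorem coe_add (ξ η : IndSpace p) : ⇑(ξ + η) = ⇑ξ + ⇑η := rfl
theorem coe_smul (c : ℂ) (ξ : IndSpace p) : ⇑(c • ξ) = c • ⇑ξ := rfl

theorem apply_eq_zero (ξ : IndSpace p) {g : G} (hg : Γ.src g ≠ p.pt) : ξ g = 0 :=
  ξ.property.1 g hg

theorem apply_mul (ξ : IndSpace p) {g : G} (h : Γ.Isotropy p.pt) (hg : Γ.src g = p.pt) :
    ξ (Γ.mul g h.1) = star (p.char h : ℂ) * ξ g :=
  ξ.property.2.1 g h hg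

theorem summable (ξ : IndSpace p) : Summable fun z : Γ.Orbit p.pt => ‖ξ z.rep‖ ^ 2 :=
  ξ.property.2.2

theorem norm_apply_eq (ξ : IndSpace p) {a b : G} (ha : Γ.src a = p.pt) (hb : Γ.src b = p.pt)
    (h : Γ.rng a = Γ.rng b) : ‖ξ b‖ = ‖ξ a‖ := by
  rw [← mul_ratio ha hb h, apply_mul _ _ ha, norm_mul, norm_star, Circle.norm_coe, one_mul]

theorem memlp (ξ : IndSpace p) : Memℓp (fun z : Γ.Orbit p.pt => ξ z.rep) 2 :=
  memℓp_gen (by simpa using ξ.summable)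

/-- The values of `ξ` at the chosen representatives, a square summable family. -/
def toLp : IndSpace p →ₗ[ℂ] lp (fun _ : Γ.Orbit p.pt => ℂ) 2 where
  toFun ξ := ⟨fun z => ξ z.rep, ξ.memlp⟩
  map_add' _ _ := rfl
  map_smul' _ _ := rfl

theorem toLp_apply (ξ : IndSpace p) (z : Γ.Orbit p.pt) : toLp ξ z = ξ z.rep := rfl

theorem ext_rep {ξ η : IndSpace p} (h : ∀ z : Γ.Orbit p.pt, ξ z.rep = η z.rep) : ξ = η := by
  refine Subtype.ext (funext fun g => ?_)
  change ξ g = η g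
  by_cases hg : Γ.src g = p.pt
  · let z : Γ.Orbit p.pt := ⟨Γ.rng g, g, hg, rfl⟩
    rw [← mul_ratio z.src_rep hg z.rng_rep, apply_mul _ _ z.src_rep, apply_mul _ _ z.src_rep, h z]
  · rw [apply_eq_zero _ hg, apply_eq_zero _ hg]

theorem toLp_injective : Function.Injective (toLp (p := p)) := fun ξ η h =>
  ext_rep fun z => by rw [← toLp_apply, ← toLp_apply, h]

theorem ratio_mul {x : X} {a b : G} (ha : Γ.src a = x) (hb : Γ.src b = x)
    (h : Γ.rng a = Γ.rng b) (k : Γ.Isotropy x)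
    (h' : Γ.rng a = Γ.rng (Γ.mul b k.1)) (hb' : Γ.src (Γ.mul b k.1) = x) :
    ratio ha hb' h' = ratio ha hb h * k :=
  Subtype.ext (Γ.mul_assoc _ _ _ ((Γ.src_inv a).trans h) (hb.trans k.2.2.symm)).symm

theorem ratio_self {x : X} {a : G} (ha : Γ.src a = x) (h : Γ.rng a = Γ.rng a) :
    ratio ha ha h = 1 :=
  Subtype.ext ((Γ.inv_mul a).trans (by rw [ha]; rfl))

open Classical in
theorem toLp_surjective : Function.Surjective (toLp (p := p)) := by
  intro v
  let z : ∀ g, Γ.src g = p.pt → Γ.Orbit p.pt := fun g hg => ⟨Γ.rng g, g, hg, rfl⟩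
  let ξ : G → ℂ := fun g => if hg : Γ.src g = p.pt then
    star (p.char (ratio (z g hg).src_rep hg (z g hg).rng_rep) : ℂ) * v (z g hg) else 0
  have hξ : ∀ w : Γ.Orbit p.pt, ξ w.rep = v w := fun w => by
    have key : ∀ (w' : Γ.Orbit p.pt) (e : w' = w) (h : Γ.rng w'.rep = Γ.rng w.rep),
        star (p.char (ratio w'.src_rep w.src_rep h) : ℂ) * v w' = v w := by
      rintro w' rfl h
      rw [ratio_self, map_one]
      simp
    have : ξ w.rep = star (p.char (ratio (z _ w.src_rep).src_rep w.src_rep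
      (z _ w.src_rep).rng_rep) : ℂ) * v (z _ w.src_rep) := dif_pos w.src_rep
    rw [this]
    exact key (z _ w.src_rep) (Subtype.ext w.rng_rep) _
  refine ⟨⟨ξ, fun g hg => dif_neg hg, fun g h hg => ?_, ?_⟩, ?_⟩
  · have hg' : Γ.src (Γ.mul g h.1) = p.pt := by
      rw [Γ.src_mul _ _ (hg.trans h.2.2.symm), h.2.1]
    have hr : Γ.rng (Γ.mul g h.1) = Γ.rng g := Γ.rng_mul _ _ (hg.trans h.2.2.symm)
    have e1 : ξ (Γ.mul g h.1) = star (p.char (ratio (z _ hg').src_rep hg'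
      (z _ hg').rng_rep) : ℂ) * v (z _ hg') := dif_pos hg'
    have e2 : ξ g = star (p.char (ratio (z _ hg).src_rep hg
      (z _ hg).rng_rep) : ℂ) * v (z _ hg) := dif_pos hg
    have key : ∀ (w w' : Γ.Orbit p.pt) (e : w = w') (h1 : Γ.rng w.rep = Γ.rng (Γ.mul g h.1))
        (h2 : Γ.rng w'.rep = Γ.rng g),
        star (p.char (ratio w.src_rep hg' h1) : ℂ) * v w =
          star (p.char h : ℂ) * (star (p.char (ratio w'.src_rep hg h2) : ℂ) * v w') := by
      rintro w _ rfl h1 h2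
      rw [ratio_mul w.src_rep hg h2 h, map_mul, Circle.coe_mul, star_mul, _root_.mul_assoc]
    rw [e1, e2]
    exact key _ _ (Subtype.ext hr) _ _
  · have := (memℓp_gen_iff (by norm_num)).1 (lp.memℓp v)
    simp only [hξ]
    simpa using this
  · refine lp.ext (funext fun w => hξ w)

/-- The norm of `IndSpace p`, given by `‖ξ‖² = ∑ ‖ξ(g)‖²`, the sum being over `G_x / G_x^x`. -/
instance : NormedAddCommGroup (IndSpace p) :=
  NormedAddCommGroup.induced (IndSpace p) (lp (fun _ : Γ.Orbit p.pt => ℂ) 2) toLp toLp_injective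

theorem norm_toLp (ξ : IndSpace p) : ‖toLp ξ‖ = ‖ξ‖ := rfl

/-- The inner product of `IndSpace p`, conjugate linear in the first variable. -/
instance : InnerProductSpace ℂ (IndSpace p) where
  norm_smul_le c ξ := by
    rw [← norm_toLp, map_smul, ← norm_toLp]
    exact norm_smul_le _ _
  inner ξ η := ⟪toLp ξ, toLp η⟫_ℂ
  norm_sq_eq_re_inner ξ := norm_sq_eq_re_inner (toLp ξ)
  conj_inner_symm ξ η := inner_conj_symm (toLp ξ) (toLp η)
  add_left ξ η ζ := by
    change ⟪toLp (ξ + η), toLp ζ⟫_ℂ = _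
    rw [map_add]
    exact inner_add_left _ _ _
  smul_left ξ η c := by
    change ⟪toLp (c • ξ), toLp η⟫_ℂ = _
    rw [map_smul]
    exact inner_smul_left _ _ _

/-- The inner product is `∑ conj (ξ(g)) η(g)`, the sum being over `G_x / G_x^x`. -/
theorem inner_eq_tsum (ξ η : IndSpace p) :
    ⟪ξ, η⟫_ℂ = ∑' z : Γ.Orbit p.pt, star (ξ z.rep) * η z.rep := by
  have : ⟪ξ, η⟫_ℂ = ⟪toLp ξ, toLp η⟫_ℂ := rfl
  rw [this, lp.inner_eq_tsum]
  exact tsum_congr fun z => by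
    rw [toLp_apply, toLp_apply, RCLike.inner_apply]
    exact mul_comm _ _

theorem norm_sq_eq_tsum (ξ : IndSpace p) :
    ‖ξ‖ ^ 2 = ∑' z : Γ.Orbit p.pt, ‖ξ z.rep‖ ^ 2 := by
  have := lp.norm_rpow_eq_tsum (p := 2) (by norm_num) (toLp ξ)
  rw [norm_toLp] at this
  simpa [toLp_apply] using this

/-- The identification of `IndSpace p` with the square summable families on the orbit. -/
def equivLp : IndSpace p ≃ₗᵢ[ℂ] lp (fun _ : Γ.Orbit p.pt => ℂ) 2 where
  toLinearEquiv := LinearEquiv.ofBijective toLp ⟨toLp_injective, toLp_surjective⟩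
  norm_map' _ := rfl

instance : CompleteSpace (IndSpace p) :=
  (completeSpace_congr (e := (equivLp (p := p)).toEquiv)
    (equivLp (p := p)).isometry.isUniformEmbedding).2 inferInstance

end IndSpace


theorem conv_apply_eq_zero {p : Γ.Char} (f : Γ.ConvAlg) (ξ : IndSpace p) {g : G}
    (hg : Γ.src g ≠ p.pt) : Γ.conv f ξ g = 0 :=
  finsum_mem_of_eqOn_zero fun h hh => by
    change f h * ξ (Γ.mul (Γ.inv h) g) = 0
    rw [ξ.apply_eq_zero, mul_zero]
    rwa [Γ.src_mul _ _ ((Γ.src_inv h).trans hh)]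

theorem conv_apply_mul {p : Γ.Char} (f : Γ.ConvAlg) (ξ : IndSpace p) {g : G}
    (k : Γ.Isotropy p.pt) (hg : Γ.src g = p.pt) :
    Γ.conv f ξ (Γ.mul g k.1) = star (p.char k : ℂ) * Γ.conv f ξ g := by
  have e : Γ.src g = Γ.rng k.1 := hg.trans k.2.2.symm
  unfold conv
  rw [mul_finsum_mem, Γ.rng_mul _ _ e]
  refine finsum_mem_congr rfl fun h hh => ?_
  have hh : Γ.rng h = Γ.rng g := hh
  have e' : Γ.src (Γ.inv h) = Γ.rng g := (Γ.src_inv h).trans hh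
  rw [← Γ.mul_assoc _ _ _ e' e, ξ.apply_mul k (by rw [Γ.src_mul _ _ e', hg])]
  ring

section Bisection

variable {p : Γ.Char} {f : Γ.ConvAlg} {W : Set G}

/-- The points of the orbit that are ranges of arrows in `W`. -/
def bisDom (p : Γ.Char) (W : Set G) : Set (Γ.Orbit p.pt) := {z | ∃ k ∈ W, Γ.rng k = z.1}

/-- The arrow in `W` with range `z`. -/
def bisArrow (z : bisDom p W) : G := z.2.choose

theorem bisArrow_mem (z : bisDom p W) : bisArrow z ∈ W := z.2.choose_spec.1

theorem rng_bisArrow (z : bisDom p W) : Γ.rng (bisArrow z) = Γ.rng z.1.rep :=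
  z.2.choose_spec.2.trans z.1.rng_rep.symm

theorem src_inv_bisArrow (z : bisDom p W) : Γ.src (Γ.inv (bisArrow z)) = Γ.rng z.1.rep :=
  (Γ.src_inv _).trans (rng_bisArrow z)

/-- The partial map of the orbit defined by `W`. -/
def bisMap (z : bisDom p W) : Γ.Orbit p.pt :=
  ⟨Γ.src (bisArrow z), Γ.mul (Γ.inv (bisArrow z)) z.1.rep, by
    rw [Γ.src_mul _ _ (src_inv_bisArrow z), z.1.src_rep], by
    rw [Γ.rng_mul _ _ (src_inv_bisArrow z), Γ.rng_inv]⟩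

theorem rng_rep_bisMap (z : bisDom p W) : Γ.rng (bisMap z).rep = Γ.src (bisArrow z) :=
  (bisMap z).rng_rep

theorem bisMap_injective (hW : Γ.IsOpenBisection W) :
    Function.Injective (bisMap : bisDom p W → Γ.Orbit p.pt) := by
  intro a b h
  have h1 : Γ.src (bisArrow a) = Γ.src (bisArrow b) := congrArg Subtype.val h
  have h2 := hW.2.1 (bisArrow_mem a) (bisArrow_mem b) h1
  have h3 := rng_bisArrow a
  rw [h2, rng_bisArrow b, Orbit.rng_rep, Orbit.rng_rep] at h3
  exact Subtype.ext (Subtype.ext h3.symm)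

theorem conv_rep (hW : Γ.IsOpenBisection W) (hf : tsupport f ⊆ W) (ξ : G → ℂ) (z : bisDom p W) :
    Γ.conv f ξ z.1.rep = f (bisArrow z) * ξ (Γ.mul (Γ.inv (bisArrow z)) z.1.rep) :=
  Γ.conv_eq_of_bisection hW (fun _ hh => eq_zero_of_notMem hf hh) (rng_bisArrow z) (bisArrow_mem z)

theorem conv_rep_eq_zero (hf : tsupport f ⊆ W) (ξ : G → ℂ) {z : Γ.Orbit p.pt}
    (hz : z ∉ bisDom p W) : Γ.conv f ξ z.rep = 0 :=
  Γ.conv_eq_zero fun h hh => eq_zero_of_notMem hf fun h' => hz ⟨h, h', hh.trans z.rng_rep⟩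

theorem norm_conv_rep_le (hW : Γ.IsOpenBisection W) (hf : tsupport f ⊆ W) {M : ℝ}
    (hM : ∀ g, ‖f g‖ ≤ M) (ξ : IndSpace p) (z : bisDom p W) :
    ‖Γ.conv f ξ z.1.rep‖ ^ 2 ≤ M ^ 2 * ‖ξ (bisMap z).rep‖ ^ 2 := by
  rw [conv_rep hW hf, norm_mul, mul_pow]
  have h1 : ‖ξ (Γ.mul (Γ.inv (bisArrow z)) z.1.rep)‖ = ‖ξ (bisMap z).rep‖ := by
    refine ξ.norm_apply_eq (bisMap z).src_rep ?_ ?_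
    · rw [Γ.src_mul _ _ (src_inv_bisArrow z), z.1.src_rep]
    · rw [Γ.rng_mul _ _ (src_inv_bisArrow z), Γ.rng_inv, rng_rep_bisMap]
  rw [h1]
  exact mul_le_mul_of_nonneg_right (pow_le_pow_left₀ (norm_nonneg _) (hM _) 2) (by positivity)

theorem support_conv_subset (hf : tsupport f ⊆ W) (ξ : G → ℂ) :
    (Function.support fun z : Γ.Orbit p.pt => ‖Γ.conv f ξ z.rep‖ ^ 2) ⊆
      Set.range (Subtype.val : bisDom p W → Γ.Orbit p.pt) := by
  intro z hz
  rw [Subtype.range_coe]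
  by_contra h
  exact hz (by simp [conv_rep_eq_zero hf ξ h])

theorem summable_conv (hW : Γ.IsOpenBisection W) (hf : tsupport f ⊆ W) (ξ : IndSpace p) :
    Summable fun z : Γ.Orbit p.pt => ‖Γ.conv f ξ z.rep‖ ^ 2 := by
  obtain ⟨M, -, hM⟩ := f.exists_norm_le
  rw [← Function.Injective.summable_iff (Subtype.val_injective (p := (· ∈ bisDom p W)))
    fun z hz => by
      by_contra h
      exact hz (support_conv_subset hf ξ h)]
  exact Summable.of_nonneg_of_le (fun _ => sq_nonneg _) (norm_conv_rep_le hW hf hM ξ)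
    ((ξ.summable.comp_injective (bisMap_injective hW)).mul_left (M ^ 2))

theorem tsum_conv_le (hW : Γ.IsOpenBisection W) (hf : tsupport f ⊆ W) {M : ℝ}
    (hM : ∀ g, ‖f g‖ ≤ M) (ξ : IndSpace p) :
    ∑' z : Γ.Orbit p.pt, ‖Γ.conv f ξ z.rep‖ ^ 2 ≤
      M ^ 2 * ∑' z : Γ.Orbit p.pt, ‖ξ z.rep‖ ^ 2 := by
  rw [← Function.Injective.tsum_eq (Subtype.val_injective (p := (· ∈ bisDom p W)))
    (support_conv_subset hf ξ)]
  have hs := ξ.summable.comp_injective (bisMap_injective (p := p) hW)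
  refine (Summable.tsum_le_tsum (norm_conv_rep_le hW hf hM ξ)
    ((summable_conv hW hf ξ).comp_injective Subtype.val_injective) (hs.mul_left _)).trans ?_
  rw [tsum_mul_left]
  refine mul_le_mul_of_nonneg_left ?_ (sq_nonneg M)
  exact tsum_comp_le_tsum_of_inj ξ.summable (fun _ => by positivity) (bisMap_injective hW)

theorem tsum_adjoint (hW : Γ.IsOpenBisection W) (hf : tsupport f ⊆ W) (ξ η : IndSpace p) :
    ∑' z : Γ.Orbit p.pt, star (Γ.conv (star f : Γ.ConvAlg) ξ z.rep) * η z.rep =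
      ∑' z : Γ.Orbit p.pt, star (ξ z.rep) * Γ.conv f η z.rep := by
  have h0 : ∀ h, h ∉ Γ.inv ⁻¹' W → (star f) h = 0 := fun h hh => by
    rw [ConvAlg.star_apply, eq_zero_of_notMem hf hh, star_zero]
  rw [← Function.Injective.tsum_eq (bisMap_injective (p := p) hW)
    (f := fun z => star (Γ.conv (star f : Γ.ConvAlg) ξ z.rep) * η z.rep),
    ← Function.Injective.tsum_eq (Subtype.val_injective (p := (· ∈ bisDom p W)))
    (f := fun z => star (ξ z.rep) * Γ.conv f η z.rep)]
  · refine tsum_congr fun z => ?_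
    have e1 : Γ.rng (Γ.inv (bisArrow z)) = Γ.rng (bisMap z).rep := by
      rw [Γ.rng_inv, rng_rep_bisMap]
    have e2 : Γ.inv (bisArrow z) ∈ Γ.inv ⁻¹' W := by
      change Γ.inv (Γ.inv _) ∈ W
      rw [Γ.inv_inv]
      exact bisArrow_mem z
    change star (Γ.conv (star f : Γ.ConvAlg) ξ (bisMap z).rep) * η (bisMap z).rep =
      star (ξ z.1.rep) * Γ.conv f η z.1.rep
    rw [conv_rep hW hf, Γ.conv_eq_of_bisection hW.inv h0 e1 e2, ConvAlg.star_apply, Γ.inv_inv]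
    set k := bisArrow z
    set b := (bisMap z).rep
    have hb : Γ.src b = p.pt := (bisMap z).src_rep
    have hkb : Γ.src k = Γ.rng b := (rng_rep_bisMap z).symm
    have ha : Γ.src (Γ.mul (Γ.inv k) z.1.rep) = p.pt := by
      rw [Γ.src_mul _ _ (src_inv_bisArrow z), z.1.src_rep]
    have hab : Γ.rng b = Γ.rng (Γ.mul (Γ.inv k) z.1.rep) := by
      rw [Γ.rng_mul _ _ (src_inv_bisArrow z), Γ.rng_inv, hkb]
    have e3 := mul_ratio hb ha hab
    have e4 : z.1.rep = Γ.mul (Γ.mul k b) (ratio hb ha hab).1 := by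
      rw [Γ.mul_assoc _ _ _ hkb (hb.trans (ratio hb ha hab).2.2.symm), e3,
        Γ.mul_inv_cancel_left (rng_bisArrow z)]
    have e5 : η (Γ.mul (Γ.inv k) z.1.rep) = star (p.char (ratio hb ha hab) : ℂ) * η b := by
      rw [← η.apply_mul _ hb, e3]
    have e6 : ξ z.1.rep = star (p.char (ratio hb ha hab) : ℂ) * ξ (Γ.mul k b) := by
      rw [← ξ.apply_mul _ (by rw [Γ.src_mul _ _ hkb, hb]), ← e4]
    have e7 : (p.char (ratio hb ha hab) : ℂ) * star (p.char (ratio hb ha hab) : ℂ) = 1 := by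
      have := Complex.mul_conj' (p.char (ratio hb ha hab) : ℂ)
      rw [Circle.norm_coe] at this
      simpa using this
    rw [e5, e6]
    simp only [star_mul, star_star]
    linear_combination (-star (ξ (Γ.mul k b)) * f k * η b) * e7
  · intro z hz
    rw [Subtype.range_coe]
    by_contra h
    exact hz (by simp [conv_rep_eq_zero hf η h])
  · intro z hz
    by_contra h
    refine hz ?_
    change star (Γ.conv (star f : Γ.ConvAlg) ξ z.rep) * η z.rep = 0
    rw [Γ.conv_eq_zero, star_zero, zero_mul]
    intro k hk
    refine h0 k fun hkW => h ?_
    have hk' : Γ.src (Γ.inv k) = Γ.rng z.rep := (Γ.src_inv k).trans hk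
    let w : bisDom p W := ⟨⟨Γ.src k, Γ.mul (Γ.inv k) z.rep,
      by rw [Γ.src_mul _ _ hk', z.src_rep], by rw [Γ.rng_mul _ _ hk', Γ.rng_inv]⟩,
      Γ.inv k, hkW, Γ.rng_inv k⟩
    have hw : bisArrow w = Γ.inv k := hW.2.2 (bisArrow_mem w) hkW
      ((rng_bisArrow w).trans (w.1.rng_rep.trans (Γ.rng_inv k).symm))
    refine ⟨w, Subtype.ext ?_⟩
    change Γ.src (bisArrow w) = z.1
    rw [hw, hk', z.rng_rep]

end Bisection

theorem conv_mem (p : Γ.Char) (f : Γ.ConvAlg) (ξ : IndSpace p) :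
    Γ.conv f ξ ∈ indSubmodule p := by
  refine ConvAlg.induction (fun f => Γ.conv f ξ ∈ indSubmodule p) ?_ ?_ ?_ f
  · rw [ConvAlg.coe_zero, zero_conv]
    exact zero_mem _
  · intro f f' hf hf'
    rw [ConvAlg.add_conv']
    exact add_mem hf hf'
  · intro f W hW hf
    exact ⟨fun g hg => conv_apply_eq_zero f ξ hg, fun g h hg => conv_apply_mul f ξ h hg,
      summable_conv hW hf ξ⟩

/-- The operator `(π(f) ξ)(g) = ∑ f(h) ξ(h⁻¹ g)`, the sum being over all `h` with the same range
as `g`. -/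
def indLin (p : Γ.Char) (f : Γ.ConvAlg) : IndSpace p →ₗ[ℂ] IndSpace p where
  toFun ξ := (⟨Γ.conv f ξ, conv_mem p f ξ⟩ : indSubmodule p)
  map_add' ξ η := Subtype.ext (ConvAlg.conv_add' f ξ η)
  map_smul' c ξ := Subtype.ext (Γ.conv_smul f ξ c)

theorem indLin_apply (p : Γ.Char) (f : Γ.ConvAlg) (ξ : IndSpace p) (g : G) :
    indLin p f ξ g = Γ.conv f ξ g := rfl

theorem indLin_add (p : Γ.Char) (f f' : Γ.ConvAlg) (ξ : IndSpace p) :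
    indLin p (f + f') ξ = indLin p f ξ + indLin p f' ξ :=
  Subtype.ext (ConvAlg.add_conv' f f' ξ)

theorem indLin_bound (p : Γ.Char) (f : Γ.ConvAlg) : ∃ C, ∀ ξ, ‖indLin p f ξ‖ ≤ C * ‖ξ‖ := by
  refine ConvAlg.induction (fun f => ∃ C, ∀ ξ, ‖indLin p f ξ‖ ≤ C * ‖ξ‖) ?_ ?_ ?_ f
  · refine ⟨0, fun ξ => ?_⟩
    have : indLin p 0 ξ = 0 := Subtype.ext (Γ.zero_conv ξ)
    rw [this, norm_zero, zero_mul]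
  · rintro f f' ⟨C, hC⟩ ⟨C', hC'⟩
    refine ⟨C + C', fun ξ => ?_⟩
    rw [indLin_add, add_mul]
    exact (norm_add_le _ _).trans (add_le_add (hC ξ) (hC' ξ))
  · intro f W hW hf
    obtain ⟨M, hM0, hM⟩ := f.exists_norm_le
    refine ⟨M, fun ξ => ?_⟩
    refine le_of_sq_le_sq ?_ (mul_nonneg hM0 (norm_nonneg _))
    rw [mul_pow, IndSpace.norm_sq_eq_tsum, IndSpace.norm_sq_eq_tsum]
    exact tsum_conv_le hW hf hM ξ

/-- The bounded operator `π(f)` of the induced representation. -/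
def indOp (p : Γ.Char) (f : Γ.ConvAlg) : IndSpace p →L[ℂ] IndSpace p :=
  (indLin p f).mkContinuousOfExistsBound (indLin_bound p f)

theorem indOp_apply (p : Γ.Char) (f : Γ.ConvAlg) (ξ : IndSpace p) (g : G) :
    indOp p f ξ g = Γ.conv f ξ g := rfl

theorem indOp_adjoint (p : Γ.Char) (f : Γ.ConvAlg) (ξ η : IndSpace p) :
    ⟪indOp p (star f) ξ, η⟫_ℂ = ⟪ξ, indOp p f η⟫_ℂ := by
  refine ConvAlg.induction
    (fun f => ⟪indOp p (star f) ξ, η⟫_ℂ = ⟪ξ, indOp p f η⟫_ℂ) ?_ ?_ ?_ f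
  · have : ∀ ξ, indOp p 0 ξ = 0 := fun ξ => Subtype.ext (Γ.zero_conv ξ)
    rw [star_zero, this, this, inner_zero_left, inner_zero_right]
  · intro f f' h h'
    have : ∀ (f f' : Γ.ConvAlg) ξ, indOp p (f + f') ξ = indOp p f ξ + indOp p f' ξ := indLin_add p
    rw [star_add, this, this, inner_add_left, inner_add_right, h, h']
  · intro f W hW hf
    rw [IndSpace.inner_eq_tsum, IndSpace.inner_eq_tsum]
    exact tsum_adjoint hW hf ξ η

/-- The representation of `C_c(G)` induced by the character `χ` of the isotropy group at `x`, where
`p = (x, χ)`. -/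
def indRep (p : Γ.Char) : Γ.Rep where
  H := IndSpace p
  hom :=
    { toFun := indOp p
      map_smul' := fun c f => ContinuousLinearMap.ext fun ξ => Subtype.ext (Γ.smul_conv f ξ c)
      map_zero' := ContinuousLinearMap.ext fun ξ => Subtype.ext (Γ.zero_conv ξ)
      map_add' := fun f f' => ContinuousLinearMap.ext fun ξ => indLin_add p f f' ξ
      map_mul' := fun f f' => ContinuousLinearMap.ext fun ξ =>
        Subtype.ext (ConvAlg.mul_conv f f' ξ)
      map_star' := fun f => (ContinuousLinearMap.eq_adjoint_iff _ _).2 fun ξ η =>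
        indOp_adjoint p f ξ η }

theorem exists_bump {U : Set G} (hU : IsOpen U) {k : G} (hk : k ∈ U) :
    ∃ f : Γ.ConvAlg, tsupport f ⊆ U ∧ f k = 1 ∧ ∀ g, ‖f g‖ ≤ 1 := by
  obtain ⟨K, hK, hkK, hKU⟩ := exists_compact_subset hU hk
  obtain ⟨φ, h1, h0, hc, h01⟩ := exists_continuous_one_zero_of_isCompact
    (isCompact_singleton (x := k)) (isClosed_compl_iff.2 (isOpen_interior (s := K)))
    (Set.disjoint_singleton_left.2 fun h => h hkK)
  let f : C_c(G, ℂ) := ⟨⟨fun g => (φ g : ℂ), by fun_prop⟩,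
    hc.comp_left (g := fun t : ℝ => (t : ℂ)) Complex.ofReal_zero⟩
  refine ⟨f, ?_, ?_, fun g => ?_⟩
  · refine subset_trans (closure_minimal ?_ hK.isClosed) hKU
    intro g hg
    by_contra h
    have : φ g = 0 := h0 fun h' => h (interior_subset h')
    exact hg (by change (φ g : ℂ) = 0; rw [this]; simp)
  · change (φ k : ℂ) = 1
    rw [h1 (Set.mem_singleton k)]
    simp
  · change ‖(φ g : ℂ)‖ ≤ 1
    rw [Complex.norm_real, Real.norm_eq_abs, abs_of_nonneg (h01 g).1]
    exact (h01 g).2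

theorem indRep_ext_toCStar (p : Γ.Char) (f : Γ.ConvAlg) :
    (indRep p).ext (Γ.toCStar f) = indOp p f := rfl

theorem indRep_nonzero (p : Γ.Char) : ∃ a ξ, (indRep p).ext a ξ ≠ 0 := by
  classical
  let z : Γ.Orbit p.pt := ⟨p.pt, Γ.unit p.pt, Γ.src_unit _, Γ.rng_unit _⟩
  obtain ⟨ξ, hξ⟩ := IndSpace.toLp_surjective (p := p) (lp.single 2 z (1 : ℂ))
  have hξz : ξ z.rep = 1 := by
    rw [← IndSpace.toLp_apply, hξ]
    simp
  obtain ⟨W, hW, hkW⟩ := Γ.exists_isOpenBisection (Γ.unit p.pt)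
  obtain ⟨f, hfW, hf1, -⟩ := exists_bump (Γ := Γ) hW.1 hkW
  refine ⟨Γ.toCStar f, ξ, fun h => ?_⟩
  have h1 : indOp p f ξ z.rep = 0 := by
    rw [show indOp p f ξ = 0 from h]
    rfl
  have hz : Γ.rng z.rep = p.pt := z.rng_rep
  have hu : Γ.mul (Γ.unit p.pt) z.rep = z.rep := by
    have := Γ.unit_mul z.rep
    rwa [hz] at this
  rw [indOp_apply, Γ.conv_eq_of_bisection hW (fun _ hh => eq_zero_of_notMem hfW hh)
    ((Γ.rng_unit _).trans hz.symm) hkW, hf1, one_mul, Γ.inv_unit, hu, hξz] at h1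
  exact one_ne_zero h1

theorem indRep_isIrreducible (p : Γ.Char) : IsIrreducibleRep (indRep p).ext := by
  classical
  refine ⟨indRep_nonzero p, fun (K : Submodule ℂ (IndSpace p)) hK hinv => ?_⟩
  by_contra! hne
  obtain ⟨hbot, htop⟩ := hne
  have : CompleteSpace K := hK.completeSpace_coe
  obtain ⟨ξ, hξK, hξ0⟩ := Submodule.exists_mem_ne_zero_of_ne_bot hbot
  obtain ⟨η, hηK, hη0⟩ := Submodule.exists_mem_ne_zero_of_ne_bot
    (fun h => htop ((Submodule.orthogonal_eq_bot_iff (K := K)).1 h))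
  have hex : ∀ ζ : IndSpace p, ζ ≠ 0 → ∃ z : Γ.Orbit p.pt, ζ z.rep ≠ 0 := fun ζ hζ => by
    by_contra! h
    exact hζ (IndSpace.ext_rep h)
  obtain ⟨z', hz'⟩ := hex ξ hξ0
  obtain ⟨z, hz⟩ := hex η hη0
  set c : ℂ := star (η z.rep) * ξ z'.rep with hc
  have hc0 : 0 < ‖c‖ := norm_pos_iff.2 (mul_ne_zero (star_ne_zero.2 hz) hz')
  let v := IndSpace.toLp η
  have hsum : HasSum (fun w => lp.single 2 w (v w)) v := lp.hasSum_single (by norm_num) v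
  have hlim : Filter.Tendsto (fun S : Finset (Γ.Orbit p.pt) =>
      ‖v - ∑ w ∈ S, lp.single 2 w (v w)‖ * ‖ξ‖) Filter.atTop (nhds 0) := by
    have h1 : Filter.Tendsto (fun S : Finset (Γ.Orbit p.pt) =>
        v - ∑ w ∈ S, lp.single 2 w (v w)) Filter.atTop (nhds (v - v)) :=
      Filter.Tendsto.sub tendsto_const_nhds hsum
    rw [sub_self] at h1
    simpa using h1.norm.mul_const ‖ξ‖
  obtain ⟨S, hSlt, hzS⟩ := ((hlim.eventually (gt_mem_nhds hc0)).and
    (Filter.eventually_ge_atTop {z})).exists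
  have hzS : z ∈ S := hzS (Finset.mem_singleton_self z)
  have e : Γ.src z.rep = Γ.rng (Γ.inv z'.rep) := by
    rw [Γ.rng_inv, z.src_rep, z'.src_rep]
  let k : G := Γ.mul z.rep (Γ.inv z'.rep)
  have hkr : Γ.rng k = Γ.rng z.rep := Γ.rng_mul _ _ e
  have hkinv : Γ.mul (Γ.inv k) z.rep = z'.rep := by
    rw [Γ.mul_inv_rev e, Γ.inv_inv, Γ.inv_mul_cancel_right (z'.src_rep.trans z.src_rep.symm)]
  obtain ⟨W, hW, hkW⟩ := Γ.exists_isOpenBisection k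
  have := Γ.t2Space_units
  let T : Set X := (fun w : Γ.Orbit p.pt => w.1) '' {w | w ∈ S ∧ w ≠ z}
  have hT : T.Finite := (S.finite_toSet.subset fun w hw => hw.1).image _
  have hV : IsOpen (Γ.rng ⁻¹' Tᶜ) := hT.isClosed.isOpen_compl.preimage Γ.continuous_rng
  obtain ⟨f, hfW, hf1, hfb⟩ := exists_bump (Γ := Γ) (hW.1.inter hV) (k := k) ⟨hkW, fun hmem => by
    obtain ⟨w, hw, hwk⟩ := hmem
    exact hw.2 (Subtype.ext (hwk.trans (hkr.trans z.rng_rep)))⟩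
  let y := IndSpace.toLp (indOp p f ξ)
  have hyz : y z = ξ z'.rep := by
    change indOp p f ξ z.rep = _
    rw [indOp_apply, Γ.conv_eq_of_bisection hW
      (fun _ hh => eq_zero_of_notMem (hfW.trans Set.inter_subset_left) hh) hkr hkW, hf1, one_mul,
      hkinv]
  have hyw : ∀ w ∈ S, w ≠ z → y w = 0 := fun w hw hwz => by
    change indOp p f ξ w.rep = _
    rw [indOp_apply]
    refine Γ.conv_eq_zero fun h hh => eq_zero_of_notMem hfW fun hmem => hmem.2 ?_
    rw [hh, w.rng_rep]
    exact ⟨w, ⟨hw, hwz⟩, rfl⟩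
  have hny : ‖y‖ ≤ ‖ξ‖ := by
    have := norm_rep_apply_le (indRep p).hom hW (hfW.trans Set.inter_subset_left) zero_le_one hfb ξ
    rw [one_mul] at this
    exact this
  have hzero : ⟪v, y⟫_ℂ = 0 := by
    have h1 : indOp p f ξ ∈ K := hinv (Γ.toCStar f) ξ hξK
    have h2 : ⟪η, indOp p f ξ⟫_ℂ = 0 := Submodule.inner_left_of_mem_orthogonal h1 hηK
    exact h2
  have hSsum : ⟪∑ w ∈ S, lp.single 2 w (v w), y⟫_ℂ = c := by
    rw [sum_inner]
    refine (Finset.sum_eq_single z ?_ ?_).trans ?_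
    · intro w hw hwz
      rw [lp.inner_single_left, hyw w hw hwz, inner_zero_right]
    · exact fun h => absurd hzS h
    · rw [lp.inner_single_left, hyz, RCLike.inner_apply, hc, mul_comm]
      rfl
  have hfin : ⟪v - ∑ w ∈ S, lp.single 2 w (v w), y⟫_ℂ = -c := by
    rw [inner_sub_left, hzero, hSsum, zero_sub]
  have := norm_inner_le_norm (𝕜 := ℂ) (v - ∑ w ∈ S, lp.single 2 w (v w)) y
  rw [hfin, norm_neg] at this
  exact absurd (this.trans (mul_le_mul_of_nonneg_left hny (norm_nonneg _))) (not_le.2 hSlt)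

/-- The set `Prim C*(G)` with the Jacobson topology. Irreducible representations on Hilbert spaces
in the universe of `G` suffice, since `C*(G)` has a dense subset that lies in this universe. -/
abbrev PrimCStar (Γ : EtaleGroupoid X G) : Type (u + 1) := CStarPrim.{u} Γ.CStar

/-- The induction map `Ind : Char(G) → Prim C*(G)`, sending `(x, χ)` to the kernel of the
representation of `C*(G)` induced by `χ`. -/
def ind (Γ : EtaleGroupoid X G) (p : Γ.Char) : Γ.PrimCStar :=
  ⟨TwoSidedIdeal.ker (indRep p).ext, (indRep p).H, inferInstance, inferInstance, inferInstance,
    (indRep p).ext, indRep_isIrreducible p, rfl⟩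

end Induced

end Algebra

end

end EtaleGroupoid

/-! ### Closures in the Jacobson topology, and positivity modulo an ideal. -/

namespace CStarPrim

universe v w

variable {A : Type w} [NonUnitalCStarAlgebra A]

/-! The argument is by contraposition: if p = (x, χ) is not in the closure of 𝒢A, an operator
inequality is built that holds in the representations π_q for all q ∈ A but fails in π_p, and such
an inequality separates `ind p` from `ind '' A`.

Let O be a neighbourhood of p that misses 𝒢A. By compactness (`Char.exists_separating`) there are ε
> 0 and finitely many t in the isotropy group at x, each with a prescribed neighbourhood N_t, such
that every (y, η) ∉ O with y close to x has an isotropy arrow h in some N_t with |η(h) - χ(t)| ≥ ε.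
Let f_t be supported in a bisection around t and equal to 1 on N_t, let u be the unit at x, put F_t
= f_t - χ(t) f_u, and let a be a cut-off with a(u) = 1, supported near u on arrows with range close
to x.

For q ∈ A, a vector ξ of π_q, and an arrow g with range close to x, write gq = (r(g), η). An
isotropy arrow h ∈ N_t at r(g) makes f_t act at g by a scalar, (f_t ξ)(g) = η(h) ξ(g)
(`conv_eq_act_char`), so (F_t ξ)(g) = (η(h) - χ(t)) ξ(g). Since gq ∈ 𝒢A lies outside O, some t gives
|(F_t ξ)(g)| ≥ ε |ξ(g)|. Summation over the orbit yields ε² π_q(a* a) ≤ ∑ π_q(F_t* F_t). In π_p,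
however, the vector δ carried by the isotropy group satisfies f_t δ = χ(t) δ (`indOp_delta`), so F_t
δ = 0 for all t while a δ = δ ≠ 0.

The inequality passes from A to p because, for self-adjoint b, positivity of π_q(b) means that the
negative part of b lies in `ind q`, and an element of all the ideals in `ind '' A` lies in every
ideal of the closure (`mem_of_mem_closure`, `norm_sq_le_sum_of_ind_mem_closure`). -/

theorem isClosed_hull {J : TwoSidedIdeal A} (hJ : IsClosed (J : Set A)) :
    IsClosed (hull J : Set (CStarPrim.{v} A)) := by
  refine ⟨?_⟩
  change (hull J : Set (CStarPrim.{v} A))ᶜᶜ ∈ _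
  exact ⟨J, hJ, compl_compl _⟩

/-- An element common to all ideals in a set `S` lies in every ideal in the closure of `S`. -/
theorem mem_of_mem_closure {S : Set (CStarPrim.{v} A)} {I : CStarPrim.{v} A}
    (hI : I ∈ closure S) {a : A} (ha : ∀ I' ∈ S, a ∈ I'.1) : a ∈ I.1 := by
  -- The intersection of the ideals in `S` is itself a closed ideal, so its hull is a closed set
  -- containing `S`, hence containing `I`.
  have hJ : IsClosed ((sInf (Subtype.val '' S) : TwoSidedIdeal A) : Set A) := by
    have : ((sInf (Subtype.val '' S) : TwoSidedIdeal A) : Set A) = ⋂ I' ∈ S, (I'.1 : Set A) := by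
      ext b
      rw [SetLike.mem_coe, TwoSidedIdeal.mem_sInf]
      simp only [Set.mem_iInter, SetLike.mem_coe]
      exact Set.forall_mem_image
    rw [this]
    exact isClosed_biInter fun I' _ => I'.isClosed_coe
  have hS : S ⊆ hull (sInf (Subtype.val '' S)) := fun I' hI' =>
    sInf_le (Set.mem_image_of_mem Subtype.val hI')
  refine closure_minimal hS (isClosed_hull hJ) hI ?_
  rw [TwoSidedIdeal.mem_sInf]
  rintro _ ⟨I', hI', rfl⟩
  exact ha I' hI'

end CStarPrim

/-- A *-homomorphism maps a self-adjoint element to a positive operator if and only if it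
annihilates the negative part. -/
theorem NonUnitalStarAlgHom.negPart_eq_zero_iff_isPositive {A : Type*} [NonUnitalCStarAlgebra A]
    {H : Type*} [NormedAddCommGroup H] [InnerProductSpace ℂ H] [CompleteSpace H]
    (π : A →⋆ₙₐ[ℂ] (H →L[ℂ] H)) {b : A} (hb : IsSelfAdjoint b) :
    π b⁻ = 0 ↔ (π b).IsPositive := by
  have hπ : Continuous π := AddMonoidHomClass.continuous_of_bound π 1 fun a => by
    rw [one_mul]
    exact NonUnitalStarAlgHom.norm_apply_le π a
  -- A continuous *-homomorphism commutes with the functional calculus, here for the function giving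
  -- the negative part, which vanishes at 0.
  have h : π b⁻ = (π b)⁻ := by
    rw [CFC.negPart_def, CFC.negPart_def]
    exact NonUnitalStarAlgHomClass.map_cfcₙ (R := ℝ) (S := ℂ) π _ b
      (hf := by fun_prop) (hf₀ := by simp) (hφ := hπ) (ha := hb) (hφa := hb.map π)
  rw [h, CFC.negPart_eq_zero_iff _ (hb.map π), ContinuousLinearMap.nonneg_iff_isPositive]

/-! ### Neighbourhoods in the space of characters. -/

namespace EtaleGroupoid

variable {X G : Type u} [TopologicalSpace X] [TopologicalSpace G]

/-- Finitely many isotropy arrows at `p` detect that a point near `p` lies outside a given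
neighbourhood of `p`. -/
theorem Char.exists_separating [T2Space G] (Γ : EtaleGroupoid X G) (p : Γ.Char)
    {N : Γ.Isotropy p.pt → Set G} (hN : ∀ t, IsOpen (N t)) (hmem : ∀ t, t.1 ∈ N t)
    {O : Set Γ.Char} (hO : IsOpen O) (hp : p ∈ O) :
    ∃ (T : Finset (Γ.Isotropy p.pt)) (ε : ℝ) (U : Set X), 0 < ε ∧ IsOpen U ∧ p.pt ∈ U ∧
      ∀ q : Γ.Char, q.pt ∈ U → q ∉ O → ∃ t ∈ T, ∃ h : Γ.Isotropy q.pt, h.1 ∈ N t ∧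
        ε ≤ ‖(q.char h : ℂ) - p.char t‖ := by
  classical
  induction hO with
  | basic O hO =>
    obtain ⟨U, K, V, hU, hK, hKiso, hV, rfl⟩ := hO
    have := Γ.t2Space_units
    have hKx : IsCompact (K ∩ Γ.rng ⁻¹' {p.pt}) :=
      hK.inter_right (isClosed_singleton.preimage Γ.continuous_rng)
    -- The centres `t` of the cover are taken in `K` itself, since only there is `p.char t` known to
    -- lie in `V`.
    have hcov : ∃ T : Finset (Γ.Isotropy p.pt), K ∩ Γ.rng ⁻¹' {p.pt} ⊆ ⋃ t ∈ T, N t ∧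
        ∀ t ∈ T, t.1 ∈ K := by
      let s : {t : Γ.Isotropy p.pt // t.1 ∈ K} → Set G := fun t => N t.1
      obtain ⟨T, hT⟩ := hKx.elim_finite_subcover s (fun t => hN _) (fun g hg =>
        Set.mem_iUnion.2 ⟨⟨⟨g, (hKiso g hg.1).trans hg.2, hg.2⟩, hg.1⟩, hmem _⟩)
      refine ⟨T.image Subtype.val, fun g hg => ?_, ?_⟩
      · obtain ⟨t, ht, htg⟩ := Set.mem_iUnion₂.1 (hT hg)
        exact Set.mem_biUnion (Finset.mem_image_of_mem _ ht) htg
      · intro t ht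
        obtain ⟨t', -, rfl⟩ := Finset.mem_image.1 ht
        exact t'.2
    obtain ⟨T, hT, hTK⟩ := hcov
    have hε : ∃ ε > 0, ∀ t ∈ T, Metric.ball (p.char t) ε ⊆ V := by
      -- The covering property is not inherited by subsets of `T`, so it must not enter the
      -- induction.
      clear hT
      induction T using Finset.induction_on with
      | empty => exact ⟨1, one_pos, by simp⟩
      | insert t T _ ih =>
        obtain ⟨ε, hε, h⟩ := ih fun t' ht' => hTK t' (Finset.mem_insert_of_mem ht')
        obtain ⟨ε', hε', h'⟩ := Metric.isOpen_iff.1 hV _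
          (hp.2 t (hTK t (Finset.mem_insert_self _ _)))
        refine ⟨min ε ε', lt_min hε hε', fun t' ht' => ?_⟩
        rcases Finset.mem_insert.1 ht' with rfl | ht'
        · exact (Metric.ball_subset_ball (min_le_right _ _)).trans h'
        · exact (Metric.ball_subset_ball (min_le_left _ _)).trans (h t' ht')
    obtain ⟨ε, hε, hball⟩ := hε
    -- Second use of compactness: the units carrying arrows of `K` not covered by the `N t` form a
    -- closed set that misses `p.pt`. Off this set, every isotropy arrow in `K` lies in some `N t`.
    have hC : IsClosed (Γ.rng '' (K \ ⋃ t ∈ T, N t)) :=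
      ((hK.diff (isOpen_biUnion fun t _ => hN t)).image Γ.continuous_rng).isClosed
    refine ⟨T, ε, U ∩ (Γ.rng '' (K \ ⋃ t ∈ T, N t))ᶜ, hε, hU.inter hC.isOpen_compl,
      ⟨hp.1, ?_⟩, fun q hqU hq => ?_⟩
    · rintro ⟨g, ⟨hg, hg'⟩, hgx⟩
      exact hg' (hT ⟨hg, hgx⟩)
    -- As `q.pt ∈ U`, the point `q` can leave the basic set only through the condition on the
    -- character.
    · have : ∃ h : Γ.Isotropy q.pt, h.1 ∈ K ∧ q.char h ∉ V := by
        by_contra! H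
        exact hq ⟨hqU.1, H⟩
      obtain ⟨h, hhK, hhV⟩ := this
      have hhN : h.1 ∈ ⋃ t ∈ T, N t := by
        by_contra H
        exact hqU.2 ⟨h.1, ⟨hhK, H⟩, h.2.2⟩
      obtain ⟨t, ht, hht⟩ := Set.mem_iUnion₂.1 hhN
      refine ⟨t, ht, h, hht, ?_⟩
      by_contra! H
      refine hhV (hball t ht ?_)
      rw [← dist_eq_norm] at H
      exact H
  -- No point lies outside the whole space, so the data are arbitrary.
  | univ => exact ⟨∅, 1, Set.univ, one_pos, isOpen_univ, trivial, fun q _ h => absurd trivial h⟩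
  | inter O O' _ _ ih ih' =>
    obtain ⟨T, ε, U, hε, hU, hpU, h⟩ := ih hp.1
    obtain ⟨T', ε', U', hε', hU', hpU', h'⟩ := ih' hp.2
    refine ⟨T ∪ T', min ε ε', U ∩ U', lt_min hε hε', hU.inter hU', ⟨hpU, hpU'⟩,
      fun q hqU hq => ?_⟩
    -- A point outside the intersection is outside one of the two sets, and the witnesses for that
    -- set serve.
    by_cases hqO : q ∈ O
    · obtain ⟨t, ht, k, hk, hle⟩ := h' q hqU.2 fun H => hq ⟨hqO, H⟩
      exact ⟨t, Finset.mem_union_right _ ht, k, hk, (min_le_right _ _).trans hle⟩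
    · obtain ⟨t, ht, k, hk, hle⟩ := h q hqU.1 hqO
      exact ⟨t, Finset.mem_union_left _ ht, k, hk, (min_le_left _ _).trans hle⟩
  | sUnion S _ ih =>
    obtain ⟨O, hOS, hpO⟩ := hp
    obtain ⟨T, ε, U, hε, hU, hpU, h⟩ := ih O hOS hpO
    exact ⟨T, ε, U, hε, hU, hpU, fun q hqU hq => h q hqU fun H => hq ⟨O, hOS, H⟩⟩

/-! ### Cut-off functions. -/

variable [T2Space G] [LocallyCompactSpace G] {Γ : EtaleGroupoid X G}

/-- The value 1 is needed on a whole neighbourhood of `k`, because the functions will be evaluated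
at isotropy arrows of other units, of which only closeness to `k` is known. -/
theorem exists_bump_eq_one {U : Set G} (hU : IsOpen U) {k : G} (hk : k ∈ U) :
    ∃ (f : Γ.ConvAlg) (N : Set G), tsupport f ⊆ U ∧ IsOpen N ∧ k ∈ N ∧ N ⊆ U ∧
      ∀ g ∈ N, f g = 1 := by
  obtain ⟨K, hK, hkK, hKU⟩ := exists_compact_subset hU hk
  -- Two nested compact sets: the function is 1 on `K`, and vanishing off the interior of `L` keeps
  -- its closed support inside `U`.
  obtain ⟨L, hL, hKL, hLU⟩ := exists_compact_between hK hU hKU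
  obtain ⟨φ, h1, h0, hc, -⟩ := exists_continuous_one_zero_of_isCompact hK
    (isClosed_compl_iff.2 (isOpen_interior (s := L))) (Set.disjoint_compl_right_iff_subset.2 hKL)
  let f : C_c(G, ℂ) := ⟨⟨fun g => (φ g : ℂ), by fun_prop⟩,
    hc.comp_left (g := fun t : ℝ => (t : ℂ)) Complex.ofReal_zero⟩
  refine ⟨f, interior K, ?_, isOpen_interior, hkK, interior_subset.trans hKU, fun g hg => ?_⟩
  · refine subset_trans (closure_minimal ?_ hL.isClosed) hLU
    intro g hg
    by_contra h
    have : φ g = 0 := h0 fun h' => h (interior_subset h')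
    exact hg (by change (φ g : ℂ) = 0; rw [this]; simp)
  · change (φ g : ℂ) = 1
    rw [h1 (interior_subset hg)]
    simp

/-! ### Vectors and operators of the induced representations at a single arrow. -/

namespace IndSpace

/-- Translation by an isotropy arrow at the range of `g` multiplies the value at `g` by the value of
the translated character. -/
theorem apply_inv_mul {q : Γ.Char} (ξ : IndSpace q) {g : G} (hg : Γ.src g = q.pt)
    (h : Γ.Isotropy (Γ.rng g)) :
    ξ (Γ.mul (Γ.inv h.1) g) = ((Γ.act g q hg).char h : ℂ) * ξ g := by
  have e : Γ.rng (Γ.mul (Γ.inv h.1) g) = Γ.rng g := by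
    rw [Γ.rng_mul _ _ ((Γ.src_inv _).trans h.2.2), Γ.rng_inv, h.2.1]
  -- Left translation by `h⁻¹` is right translation by g⁻¹h⁻¹g, an isotropy arrow at the source.
  -- Equivariance then gives the conjugate of the character at that inverse, that is, its value at
  -- g⁻¹hg.
  have h1 : Γ.mul (Γ.inv h.1) g = Γ.mul g (Γ.conjInv g hg h⁻¹).1 :=
    (Γ.mul_inv_cancel_left e.symm).symm
  rw [h1, ξ.apply_mul _ hg, map_inv, map_inv, Circle.coe_inv_eq_conj]
  change star (star (q.char (Γ.conjInv g hg h) : ℂ)) * ξ g = _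
  rw [star_star]
  rfl

/-- There is a vector in the induced space that is supported on the isotropy group and is `1` at
the unit. -/
theorem exists_delta (p : Γ.Char) :
    ∃ δ : IndSpace p, δ (Γ.unit p.pt) = 1 ∧ ∀ g, Γ.rng g ≠ p.pt → δ g = 0 := by
  classical
  let z : Γ.Orbit p.pt := ⟨p.pt, Γ.unit p.pt, Γ.src_unit _, Γ.rng_unit _⟩
  obtain ⟨ξ, hξ⟩ := IndSpace.toLp_surjective (p := p) (lp.single 2 z (1 : ℂ))
  have hξz : ξ z.rep = 1 := by
    rw [← IndSpace.toLp_apply, hξ]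
    simp
  -- The chosen representative `z.rep` need not be the unit. The two differ by an isotropy arrow, so
  -- the value at the unit still has modulus 1, and `ξ` can be normalised by it.
  have h1 : ξ (Γ.unit p.pt) ≠ 0 := by
    rw [← norm_ne_zero_iff, ξ.norm_apply_eq z.src_rep (Γ.src_unit _)
      (z.rng_rep.trans (Γ.rng_unit _).symm), hξz, norm_one]
    exact one_ne_zero
  refine ⟨(ξ (Γ.unit p.pt))⁻¹ • ξ, inv_mul_cancel₀ h1, fun g hg => ?_⟩
  have h2 : ξ g = 0 := by
    by_cases hs : Γ.src g = p.pt
    · let w : Γ.Orbit p.pt := ⟨Γ.rng g, g, hs, rfl⟩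
      have hwz : w ≠ z := fun h => hg (congrArg Subtype.val h)
      rw [← norm_eq_zero, ξ.norm_apply_eq w.src_rep hs w.rng_rep, ← IndSpace.toLp_apply, hξ]
      simp [hwz]
    · exact ξ.apply_eq_zero hs
  rw [coe_smul, Pi.smul_apply, h2, smul_zero]

theorem apply_isotropy {p : Γ.Char} {δ : IndSpace p} (hδ : δ (Γ.unit p.pt) = 1)
    (m : Γ.Isotropy p.pt) : δ m.1 = star (p.char m : ℂ) := by
  have h1 := δ.apply_mul m (Γ.src_unit p.pt)
  have h2 := Γ.unit_mul m.1
  rw [m.2.2] at h2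
  rwa [h2, hδ, mul_one] at h1

end IndSpace

/-- On the isotropy group the only arrow of `W` that contributes is `k`, and it translates δ, which
equals the conjugate of χ there, by `k`. Elsewhere nothing arises: an arrow of `W` with source
`p.pt` must be `k`, whose range is again `p.pt`. Thus δ is an eigenvector. -/
theorem indOp_delta {p : Γ.Char} {δ : IndSpace p} (hδ : δ (Γ.unit p.pt) = 1)
    (hδ0 : ∀ g, Γ.rng g ≠ p.pt → δ g = 0) {f : Γ.ConvAlg} {W : Set G} (hW : Γ.IsOpenBisection W)
    (hf : tsupport f ⊆ W) (k : Γ.Isotropy p.pt) (hkW : k.1 ∈ W) (hfk : f k.1 = 1) :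
    indOp p f δ = (p.char k : ℂ) • δ := by
  refine Subtype.ext (funext fun g => ?_)
  change indOp p f δ g = (p.char k : ℂ) * δ g
  by_cases hg : Γ.src g = p.pt
  swap
  · rw [IndSpace.apply_eq_zero _ hg, δ.apply_eq_zero hg, mul_zero]
  rw [indOp_apply]
  by_cases hr : Γ.rng g = p.pt
  · let m : Γ.Isotropy p.pt := ⟨g, hg, hr⟩
    rw [Γ.conv_eq_of_bisection hW (fun _ => eq_zero_of_notMem hf) (k.2.2.trans hr.symm) hkW, hfk,
      one_mul]
    have h1 : δ (Γ.mul (Γ.inv k.1) g) = star (p.char (k⁻¹ * m) : ℂ) :=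
      IndSpace.apply_isotropy hδ (k⁻¹ * m)
    have h2 : δ g = star (p.char m : ℂ) := IndSpace.apply_isotropy hδ m
    rw [h1, h2, map_mul, map_inv, Circle.coe_mul, Circle.coe_inv_eq_conj, star_mul']
    change star (star _) * _ = _
    rw [star_star]
  · rw [hδ0 g hr, mul_zero]
    refine finsum_mem_of_eqOn_zero fun h hh => ?_
    have hh : Γ.rng h = Γ.rng g := hh
    change f h * δ (Γ.mul (Γ.inv h) g) = 0
    by_cases hhW : h ∈ W
    -- Here injectivity of the source map on the bisection is used, whereas evaluation on the
    -- isotropy group used injectivity of the range map.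
    · rw [hδ0, mul_zero]
      rw [Γ.rng_mul _ _ ((Γ.src_inv h).trans hh), Γ.rng_inv]
      intro hs
      have : h = k.1 := hW.2.1 hhW hkW (hs.trans k.2.1.symm)
      exact hr (by rw [← hh, this, k.2.2])
    · rw [eq_zero_of_notMem hf hhW, zero_mul]

/-- The arrow `h` is the only one in `W` with range `rng g`, so the convolution has a single term.
This is where the translated point `g q`, and hence the saturation of `A`, enters. -/
theorem conv_eq_act_char {q : Γ.Char} (ξ : IndSpace q) {f : Γ.ConvAlg} {W : Set G}
    (hW : Γ.IsOpenBisection W) (hf : tsupport f ⊆ W) {g : G} (hg : Γ.src g = q.pt)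
    (h : Γ.Isotropy (Γ.rng g)) (hh : h.1 ∈ W) :
    Γ.conv f ξ g = f h.1 * (((Γ.act g q hg).char h : ℂ) * ξ g) := by
  rw [Γ.conv_eq_of_bisection hW (fun _ => eq_zero_of_notMem hf) h.2.2 hh, ξ.apply_inv_mul hg]

theorem conv_eq_unit {f : Γ.ConvAlg} {W : Set G} (hW : Γ.IsOpenBisection W)
    (hf : tsupport f ⊆ W) (ξ : G → ℂ) {g : G} (hg : Γ.unit (Γ.rng g) ∈ W) :
    Γ.conv f ξ g = f (Γ.unit (Γ.rng g)) * ξ g := by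
  rw [Γ.conv_eq_of_bisection hW (fun _ => eq_zero_of_notMem hf) (Γ.rng_unit _) hg, Γ.inv_unit,
    Γ.unit_mul]

/-! ### Transfer of operator inequalities to the closure. -/

theorem inner_rep_star_mul_self {H : Type*} [NormedAddCommGroup H] [InnerProductSpace ℂ H]
    [CompleteSpace H] (ρ : Γ.ConvAlg →⋆ₙₐ[ℂ] (H →L[ℂ] H)) (f : Γ.ConvAlg) (ξ : H) :
    ⟪ρ (star f * f) ξ, ξ⟫_ℂ = (‖ρ f ξ‖ ^ 2 : ℝ) := by
  rw [map_mul, mul_apply_eq_comp, map_star]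
  refine (ContinuousLinearMap.adjoint_inner_left (ρ f) ξ (ρ f ξ)).trans ?_
  rw [inner_self_eq_norm_sq_to_K]
  simp

/-- Positivity of a self-adjoint element of `C_c(G)` passes to the closure of a set of induced
primitive ideals. -/
theorem isPositive_of_ind_mem_closure {p : Γ.Char} {A : Set Γ.Char}
    (h : Γ.ind p ∈ closure (Γ.ind '' A)) {b : Γ.ConvAlg} (hb : IsSelfAdjoint b)
    (hA : ∀ q ∈ A, (indOp q b).IsPositive) : (indOp p b).IsPositive := by
  have hb' : IsSelfAdjoint (Γ.toCStar b) := hb.map Γ.toCStar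
  -- One element of C*(𝒢), the negative part of `b`, tests positivity in all induced representations
  -- at once.
  have key : ∀ q : Γ.Char, (Γ.toCStar b)⁻ ∈ (Γ.ind q).1 ↔ (indOp q b).IsPositive := fun q =>
    (TwoSidedIdeal.mem_ker _).trans
      (NonUnitalStarAlgHom.negPart_eq_zero_iff_isPositive (indRep q).ext hb')
  refine (key p).1 (CStarPrim.mem_of_mem_closure h ?_)
  rintro _ ⟨q, hq, rfl⟩
  exact (key q).2 (hA q hq)

/-- Domination of a positive element by a sum of positive elements, tested in norm on the induced
representations of a set of points, passes to the closure. -/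
theorem norm_sq_le_sum_of_ind_mem_closure {p : Γ.Char} {A : Set Γ.Char}
    (h : Γ.ind p ∈ closure (Γ.ind '' A)) {ι : Type*} (T : Finset ι) (F : ι → Γ.ConvAlg)
    (a : Γ.ConvAlg) (hA : ∀ q ∈ A, ∀ ξ : IndSpace q,
      ‖indOp q a ξ‖ ^ 2 ≤ ∑ t ∈ T, ‖indOp q (F t) ξ‖ ^ 2) (ξ : IndSpace p) :
    ‖indOp p a ξ‖ ^ 2 ≤ ∑ t ∈ T, ‖indOp p (F t) ξ‖ ^ 2 := by
  let b : Γ.ConvAlg := ∑ t ∈ T, star (F t) * F t - star a * a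
  have hb : IsSelfAdjoint b := by
    change star b = b
    simp only [b, star_sub, star_sum, star_mul, star_star]
  -- The quadratic form of `b` is the difference of the two sides of the inequality, so the
  -- inequality for all vectors of `q` is positivity of `indOp q b`.
  have hin : ∀ (q : Γ.Char) (ξ : IndSpace q), ⟪indOp q b ξ, ξ⟫_ℂ =
      (∑ t ∈ T, ‖indOp q (F t) ξ‖ ^ 2 - ‖indOp q a ξ‖ ^ 2 : ℝ) := fun q ξ => by
    have h1 : indOp q b ξ =
        ∑ t ∈ T, indOp q (star (F t) * F t) ξ - indOp q (star a * a) ξ := by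
      have h2 : (indRep q).hom b =
          ∑ t ∈ T, (indRep q).hom (star (F t) * F t) - (indRep q).hom (star a * a) := by
        rw [map_sub, map_sum]
      let ev := ContinuousLinearMap.apply ℂ (indRep q).H (show (indRep q).H from ξ)
      refine (congrArg ev h2).trans ((map_sub ev _ _).trans ?_)
      rw [map_sum ev]
      rfl
    have h4 : ∀ f : Γ.ConvAlg, ⟪indOp q (star f * f) ξ, ξ⟫_ℂ = (‖indOp q f ξ‖ ^ 2 : ℝ) :=
      fun f => inner_rep_star_mul_self (indRep q).hom f ξ
    rw [h1, inner_sub_left, sum_inner, h4, Finset.sum_congr rfl fun t _ => h4 (F t)]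
    push_cast
    rfl
  have hpos : (indOp p b).IsPositive := by
    refine isPositive_of_ind_mem_closure h hb fun q hq => ?_
    rw [ContinuousLinearMap.isPositive_iff_complex]
    intro ξ
    rw [hin q ξ]
    exact ⟨congrArg _ (Complex.ofReal_re _),
      (sub_nonneg.2 (hA q hq ξ)).trans_eq (Complex.ofReal_re _).symm⟩
  have h5 := ((ContinuousLinearMap.isPositive_iff_complex _).1 hpos ξ).2
  rw [hin p ξ] at h5
  exact sub_nonneg.1 (h5.trans_eq (Complex.ofReal_re _))

end EtaleGroupoid

/-! ### The separating inequality and the contradiction. -/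

theorem theorem2 {X G : Type u} [TopologicalSpace X] [TopologicalSpace G] [T2Space G]
    [LocallyCompactSpace G] (Γ : EtaleGroupoid X G) (p : Γ.Char) (A : Set Γ.Char)
    (h : Γ.ind p ∈ closure (Γ.ind '' A)) : p ∈ closure (Γ.saturation A) := by
  classical
  by_contra hp
  choose W hW hmW using Γ.exists_isOpenBisection
  choose f N hfW hN hmN hNW hf1 using fun k : G =>
    EtaleGroupoid.exists_bump_eq_one (Γ := Γ) (hW k).1 (hmW k)
  obtain ⟨T, ε, U, hε, hU, hpU, hsep⟩ := EtaleGroupoid.Char.exists_separating Γ p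
    (N := fun t => N t.1) (fun t => hN _) (fun t => hmN _) isClosed_closure.isOpen_compl hp
  let u : G := Γ.unit p.pt
  -- The condition `Γ.unit y ∈ N u` ensures that `f u` is 1 at the unit `y`, so that `f u` acts as
  -- the identity at arrows with range `y`.
  let U' : Set X := U ∩ Γ.unit ⁻¹' N u
  have hU' : IsOpen U' := hU.inter ((hN u).preimage Γ.continuous_unit)
  -- The cut-off kills the values at arrows with range outside `U'`, where no separation is
  -- available.
  obtain ⟨a, haU, ha1, hab⟩ := EtaleGroupoid.exists_bump (Γ := Γ) (k := u)
    ((hW u).1.inter (hU'.preimage Γ.continuous_rng)) ⟨hmW u, by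
      rw [Set.mem_preimage, Γ.rng_unit]
      exact ⟨hpU, hmN u⟩⟩
  have haW := haU.trans Set.inter_subset_left
  let F : Γ.Isotropy p.pt → Γ.ConvAlg := fun t => f t.1 - (p.char t : ℂ) • f u
  have hF : ∀ (q : Γ.Char) (t) (ξ : EtaleGroupoid.IndSpace q), EtaleGroupoid.indOp q (F t) ξ =
      EtaleGroupoid.indOp q (f t.1) ξ - (p.char t : ℂ) • EtaleGroupoid.indOp q (f u) ξ :=
    fun q t ξ => by
      have h1 : (EtaleGroupoid.indRep q).hom (F t) = (EtaleGroupoid.indRep q).hom (f t.1) -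
          (p.char t : ℂ) • (EtaleGroupoid.indRep q).hom (f u) := by
        rw [map_sub, map_smul]
      exact congrArg (fun S : (EtaleGroupoid.indRep q).H →L[ℂ] _ => S ξ) h1
  obtain ⟨δ, hδ, hδ0⟩ := EtaleGroupoid.IndSpace.exists_delta p
  have hδf : ∀ t : Γ.Isotropy p.pt, EtaleGroupoid.indOp p (f t.1) δ = (p.char t : ℂ) • δ :=
    fun t => EtaleGroupoid.indOp_delta hδ hδ0 (hW t.1) (hfW t.1) t (hmW _) (hf1 _ _ (hmN _))
  have hδu : EtaleGroupoid.indOp p (f u) δ = δ := by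
    -- The identity of the isotropy group is the unit `u`, where the character is 1.
    have := hδf 1
    rwa [map_one, Circle.coe_one, one_smul] at this
  have hδa : EtaleGroupoid.indOp p a δ = δ := by
    have := EtaleGroupoid.indOp_delta hδ hδ0 (hW u) haW 1 (hmW _) ha1
    rwa [map_one, Circle.coe_one, one_smul] at this
  have hsmul : ∀ (q : Γ.Char) (ξ : EtaleGroupoid.IndSpace q),
      ‖EtaleGroupoid.indOp q ((ε : ℂ) • a) ξ‖ ^ 2 = ε ^ 2 * ‖EtaleGroupoid.indOp q a ξ‖ ^ 2 :=
    fun q ξ => by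
      have h1 : EtaleGroupoid.indOp q ((ε : ℂ) • a) ξ = (ε : ℂ) • EtaleGroupoid.indOp q a ξ :=
        congrArg (fun S : (EtaleGroupoid.indRep q).H →L[ℂ] _ => S ξ)
          (map_smul (EtaleGroupoid.indRep q).hom (ε : ℂ) a)
      rw [h1, norm_smul, Complex.norm_real, Real.norm_eq_abs, mul_pow, sq_abs]
  have hmain := EtaleGroupoid.norm_sq_le_sum_of_ind_mem_closure h T F ((ε : ℂ) • a) ?_ δ
  · rw [hsmul, hδa, Finset.sum_eq_zero fun t _ => by
      rw [hF, hδf, hδu, sub_self, norm_zero, sq, mul_zero]] at hmain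
    have hδne : δ ≠ 0 := by
      rintro rfl
      exact zero_ne_one hδ
    have := norm_pos_iff.2 hδne
    exact absurd hmain (not_le.2 (by positivity))
  · intro q hq ξ
    have hsum : ∀ t ∈ T, Summable fun z : Γ.Orbit q.pt =>
        ‖EtaleGroupoid.indOp q (F t) ξ z.rep‖ ^ 2 := fun t _ =>
      (EtaleGroupoid.indOp q (F t) ξ).summable
    rw [hsmul, EtaleGroupoid.IndSpace.norm_sq_eq_tsum, ← tsum_mul_left]
    simp_rw [EtaleGroupoid.IndSpace.norm_sq_eq_tsum]
    rw [← Summable.tsum_finsetSum hsum]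
    -- The inequality holds term by term over the orbit.
    refine Summable.tsum_le_tsum (fun z => ?_)
      ((EtaleGroupoid.indOp q a ξ).summable.mul_left _) (summable_sum hsum)
    have hnn : 0 ≤ ∑ t ∈ T, ‖EtaleGroupoid.indOp q (F t) ξ z.rep‖ ^ 2 :=
      Finset.sum_nonneg fun _ _ => sq_nonneg _
    by_cases hz : Γ.rng z.rep ∈ U'
    · have hzu : Γ.unit (Γ.rng z.rep) ∈ N u := hz.2
      -- The point `z.rep · q` belongs to the saturation of `A`, hence not to the complement of its
      -- closure. The term of the resulting `t` alone dominates the left side.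
      obtain ⟨t, ht, k, hkN, hle⟩ := hsep (Γ.act z.rep q z.src_rep) hz.1
        (fun H => H (subset_closure ⟨q, hq, z.rep, z.src_rep, rfl⟩))
      refine le_trans ?_ (Finset.single_le_sum (fun _ _ => sq_nonneg _) ht)
      have h1 : EtaleGroupoid.indOp q (F t) ξ z.rep =
          (((Γ.act z.rep q z.src_rep).char k : ℂ) - p.char t) * ξ z.rep := by
        rw [hF]
        change Γ.conv (f t.1) ξ z.rep - (p.char t : ℂ) * Γ.conv (f u) ξ z.rep = _
        rw [EtaleGroupoid.conv_eq_act_char ξ (hW _) (hfW _) z.src_rep k (hNW _ hkN),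
          EtaleGroupoid.conv_eq_unit (hW u) (hfW u) ξ (hNW _ hzu), hf1 _ _ hkN, hf1 _ _ hzu]
        ring
      have h2 : ‖EtaleGroupoid.indOp q a ξ z.rep‖ ≤ ‖ξ z.rep‖ := by
        rw [EtaleGroupoid.indOp_apply, EtaleGroupoid.conv_eq_unit (hW u) haW ξ (hNW _ hzu),
          norm_mul]
        exact mul_le_of_le_one_left (norm_nonneg _) (hab _)
      rw [h1, norm_mul, mul_pow]
      gcongr
    · have h1 : EtaleGroupoid.indOp q a ξ z.rep = 0 := by
        rw [EtaleGroupoid.indOp_apply]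
        refine Γ.conv_eq_zero fun k hk => EtaleGroupoid.eq_zero_of_notMem haU fun hkU => hz ?_
        rw [← hk]
        exact hkU.2
      rwa [h1, norm_zero, zero_pow two_ne_zero, mul_zero]
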